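/- Let $\mathbb{H}^n$ be the Heisenberg group: $\mathbb{R}^{2n+1}$ with points $\xi=(z,t)=(x,y,t)$, group law $\xi\circ\xi'=(x+x',\,y+y',\,t+t'+2\langle y,x'\rangle-2\langle x,y'\rangle)$, dilations $\Phi_\lambda(z,t)=(\lambda z,\lambda^2 t)$ for $\lambda>0$, Lebesgue measure, homogeneous dimension $Q=2n+2$ and standard norm $|\xi|_{\mathbb{H}^n}=(|z|^4+t^2)^{1/4}$. Let $s\in(0,1)$, $p\in(1,\infty)$, and let $d_{\mathrm o}:\mathbb{H}^n\to[0,\infty)$ be a homogeneous norm, i.e. a continuous function with $d_{\mathrm o}(\Phi_\lambda(\xi))=\lambda\, d_{\mathrm o}(\xi)$ for all $\lambda>0$ and $\xi\in\mathbb{H}^n$, and $d_{\mathrm o}(\xi)=0$ if and only if $\xi=0$. For an open set $U\subseteq\mathbb{H}^n$ let $$W^{s,p}(U)=\Big\{u\in L^p(U):\ \frac{|u(\xi)-u(\eta)|}{|\eta^{-1}\circ\xi|_{\mathbb{H}^n}^{Q/p+s}}\in L^p(U\times U)\Big\}.$$ Let $\Omega,\Omega'\subset\mathbb{H}^n$ be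 bounded open sets with $\overline\Omega\subset\Omega'$, let $h:\mathbb{H}^n\to[-\infty,\infty)$ and $g\in W^{s,p}(\mathbb{H}^n)$, and put $$\mathcal{K}_{g,h}(\Omega,\Omega')=\{u\in W^{s,p}(\Omega'):\ u\ge h\text{ a.e. in }\Omega,\ u=g\text{ a.e. in }\mathbb{H}^n\setminus\Omega\},$$ a set of real functions on $\mathbb{H}^n$, identified when they agree almost everywhere. Let $f:\mathbb{H}^n\times\mathbb{R}\to\mathbb{R}$ satisfy: (i) $f(\cdot,x)$ is measurable for every $x\in\mathbb{R}$, and $f(\xi,\cdot)$ is continuous for a.e. $\xi\in\mathbb{H}^n$; (ii) $f(\cdot,x)\in L^\infty_{\rm loc}(\mathbb{H}^n)$ for every $x\in\mathbb{R}$, and the bound on $\Omega$ is uniform in $x$: $\sup_{x\in\mathbb{R}}\|f(\cdot,x)\|_{L^\infty(\Omega)}<\infty$; (iii) $(f(\xi,x_1)-f(\xi,x_2))(x_1-x_2)\le 0$ for all $x_1,x_2\in\mathbb{R}$ and a.e. $\xi\in\mathbb{H}^n$. Define $$\langle\mathbf{A}(u),v\rangle=\int_{\mathbb{H}^n}\int_{\mathbb{H}^n}\frac{|u(\xi)-u(\eta)|^{p-2}(u(\xi)-u(\eta))(v(\xi)-v(\eta))}{d_{\mathrm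 o}(\eta^{-1}\circ\xi)^{Q+sp}}\,d\xi\,d\eta-\int_\Omega f(\xi,u(\xi))\,v(\xi)\,d\xi .$$ If $\mathcal{K}_{g,h}(\Omega,\Omega')\ne\emptyset$, then the integrals in $\langle\mathbf{A}(u),v-u\rangle$ converge absolutely for all $u,v\in\mathcal{K}_{g,h}(\Omega,\Omega')$, and there is exactly one $u\in\mathcal{K}_{g,h}(\Omega,\Omega')$ (up to equality almost everywhere) such that $$\langle\mathbf{A}(u),v-u\rangle\ge 0\qquad\text{for all }v\in\mathcal{K}_{g,h}(\Omega,\Omega').$$ -/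

import Mathlib

open MeasureTheory

noncomputable section

/-- Points `ξ = (x, y, t)` of the Heisenberg group `ℍⁿ`, i.e. `ℝ²ⁿ⁺¹` with its usual topology and
Lebesgue measure. The group law is `Heis.mul` (with neutral element `0`), not the componentwise
product. -/
abbrev Heis (n : ℕ) : Type := (Fin n → ℝ) × (Fin n → ℝ) × ℝ

namespace Heis

variable {n : ℕ}

/-- `ξ ∘ ξ' = (x + x', y + y', t + t' + 2⟨y, x'⟩ - 2⟨x, y'⟩)`. -/
def mul (ξ ξ' : Heis n) : Heis n :=
  (ξ.1 + ξ'.1, ξ.2.1 + ξ'.2.1,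
    ξ.2.2 + ξ'.2.2 + 2 * (∑ i, ξ.2.1 i * ξ'.1 i) - 2 * (∑ i, ξ.1 i * ξ'.2.1 i))

/-- The inverse for the group law `Heis.mul`. -/
def inv (ξ : Heis n) : Heis n := (-ξ.1, -ξ.2.1, -ξ.2.2)

theorem mul_assoc (ξ η ζ : Heis n) : mul (mul ξ η) ζ = mul ξ (mul η ζ) := by
  refine Prod.ext ?_ (Prod.ext ?_ ?_)
  · simp [mul, add_assoc]
  · simp [mul, add_assoc]
  · simp only [mul, Pi.add_apply, add_mul, mul_add, Finset.sum_add_distrib]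
    ring

theorem inv_mul_self (ξ : Heis n) : mul (inv ξ) ξ = 0 := by
  refine Prod.ext ?_ (Prod.ext ?_ ?_)
  · simp [mul, inv]
  · simp [mul, inv]
  · simp [mul, inv, mul_comm]

/-- The dilations `Φ_r(z, t) = (r z, r² t)`. -/
def dil (r : ℝ) (ξ : Heis n) : Heis n := (r • ξ.1, r • ξ.2.1, r ^ 2 * ξ.2.2)

/-- The homogeneous dimension `Q = 2n + 2`, as a real number. -/
def homDim (n : ℕ) : ℝ := 2 * n + 2

/-- The standard homogeneous norm `(|z|⁴ + t²)^(1/4)`, where `|z|² = |x|² + |y|²`. -/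
def stdNorm (ξ : Heis n) : ℝ :=
  (((∑ i, ξ.1 i ^ 2) + ∑ i, ξ.2.1 i ^ 2) ^ 2 + ξ.2.2 ^ 2) ^ (1 / 4 : ℝ)

/-- Homogeneous norms on `ℍⁿ` (neither symmetry nor a triangle inequality is required). -/
structure IsHomogeneousNorm (d : Heis n → ℝ) : Prop where
  continuous : Continuous d
  nonneg : ∀ ξ, 0 ≤ d ξ
  map_dil : ∀ r : ℝ, 0 < r → ∀ ξ, d (dil r ξ) = r * d ξ
  eq_zero_iff : ∀ ξ, d ξ = 0 ↔ ξ = 0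

/-- `u ∈ W^{s,p}(U)`: `u ∈ L^p(U)` and
`|u(ξ) - u(η)| / |η⁻¹ ∘ ξ|^{Q/p + s} ∈ L^p(U × U)`. -/
def MemWsp (s p : ℝ) (U : Set (Heis n)) (u : Heis n → ℝ) : Prop :=
  MemLp u (ENNReal.ofReal p) (volume.restrict U) ∧
  MemLp (fun z : Heis n × Heis n =>
      |u z.1 - u z.2| / stdNorm (mul (inv z.2) z.1) ^ (homDim n / p + s))
    (ENNReal.ofReal p) ((volume.restrict U).prod (volume.restrict U))

/-- The admissible class `K_{g,h}(Ω, Ω')`; its elements are functions on all of `ℍⁿ`, to be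
identified when they agree almost everywhere. -/
def obstacleClass (s p : ℝ) (g : Heis n → ℝ) (h : Heis n → EReal) (Ω Ω' : Set (Heis n)) :
    Set (Heis n → ℝ) :=
  {u | MemWsp s p Ω' u ∧ (∀ᵐ ξ ∂(volume.restrict Ω), h ξ ≤ (u ξ : EReal)) ∧
    (∀ᵐ ξ ∂(volume.restrict Ωᶜ), u ξ = g ξ)}

/-- `|u(ξ)-u(η)|^{p-2} (u(ξ)-u(η)) (v(ξ)-v(η)) / d(η⁻¹ ∘ ξ)^{Q+sp}` at `z = (ξ, η)`. -/
def formIntegrand (d : Heis n → ℝ) (s p : ℝ) (u v : Heis n → ℝ) (z : Heis n × Heis n) : ℝ :=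
  |u z.1 - u z.2| ^ (p - 2) * (u z.1 - u z.2) * (v z.1 - v z.2) /
    d (mul (inv z.2) z.1) ^ (homDim n + s * p)

/-- The pairing `⟨A(u), v⟩`. -/
def pairing (d : Heis n → ℝ) (s p : ℝ) (f : Heis n → ℝ → ℝ) (Ω : Set (Heis n))
    (u v : Heis n → ℝ) : ℝ :=
  (∫ z : Heis n × Heis n, formIntegrand d s p u v z) - ∫ ξ in Ω, f ξ (u ξ) * v ξ

/-- `u` solves the obstacle problem in `K_{g,h}(Ω, Ω')`. -/
def IsObstacleSolution (d : Heis n → ℝ) (s p : ℝ) (f : Heis n → ℝ → ℝ) (g : Heis n → ℝ)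
    (h : Heis n → EReal) (Ω Ω' : Set (Heis n)) (u : Heis n → ℝ) : Prop :=
  u ∈ obstacleClass s p g h Ω Ω' ∧
    ∀ v ∈ obstacleClass s p g h Ω Ω', 0 ≤ pairing d s p f Ω u (v - u)

/-- `f(·, x)` is (Lebesgue) measurable for all `x`, and `f(ξ, ·)` is continuous for a.e. `ξ`. -/
def IsCaratheodory (f : Heis n → ℝ → ℝ) : Prop :=
  (∀ x, AEMeasurable (fun ξ => f ξ x) volume) ∧ ∀ᵐ ξ, Continuous (f ξ)

/-- `f(·, x) ∈ L^∞_loc(ℍⁿ)` for every `x`, with a bound on `Ω` that is uniform in `x`. -/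
def IsLocBoundedUnif (f : Heis n → ℝ → ℝ) (Ω : Set (Heis n)) : Prop :=
  (∀ x, ∀ K : Set (Heis n), IsCompact K →
    ∃ C : ℝ, ∀ᵐ ξ ∂(volume.restrict K), |f ξ x| ≤ C) ∧
  ∃ M : ℝ, ∀ x, ∀ᵐ ξ ∂(volume.restrict Ω), |f ξ x| ≤ M

/-- `(f(ξ, x₁) - f(ξ, x₂)) (x₁ - x₂) ≤ 0` for all `x₁, x₂` and a.e. `ξ`. -/
def IsNonincreasing (f : Heis n → ℝ → ℝ) : Prop :=
  ∀ x₁ x₂ : ℝ, ∀ᵐ ξ, (f ξ x₁ - f ξ x₂) * (x₁ - x₂) ≤ 0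

end Heis

end

/-!
The kernel `d(η⁻¹ ∘ ξ)^{-(Q + sp)}` is comparable to its counterpart for the standard norm and is
integrable away from the diagonal. Hence a function of `W^{s,p}(Ω')` that vanishes off `Ω` has
finite Gagliardo seminorm on the whole group, and the obstacle class consists of the functions of
finite global energy that lie above `h` in `Ω` and equal `g` outside.

The operator is the derivative of the energy `p⁻¹ [u]^p - ∫_Ω F(ξ, u)`, where `F` is the primitive
of `f` in its second variable. This energy is convex because `f` is nonincreasing, and coercive
because comparing `Ω` with a ball disjoint from it gives a fractional Poincaré inequality for
functions vanishing off `Ω`. The convexity defect of `|x|^p` at a midpoint controls `|a - b|^p` up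
to a small multiple of `|a|^p + |b|^p`, so minimising sequences are Cauchy; their limits minimise
the energy, and two minimisers agree almost everywhere. By convexity and Minty's trick the
minimisers are exactly the solutions of the variational inequality.
-/

noncomputable section

open Filter Topology
open scoped ENNReal NNReal

namespace NonlocalObstacle

/-! ### Inequalities for `|x| ^ p` -/

theorem add_mul_sub_le_of_convexOn {S : Set ℝ} {φ : ℝ → ℝ} {a b φ' : ℝ} (hφ : ConvexOn ℝ S φ)
    (ha : a ∈ S) (hb : b ∈ S) (hd : HasDerivAt φ φ' b) : φ b + φ' * (a - b) ≤ φ a := by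
  rcases lt_trichotomy a b with h | rfl | h
  · have := hφ.slope_le_of_hasDerivAt ha hb h hd
    rw [slope_def_field, div_le_iff₀ (sub_pos.2 h)] at this
    linarith
  · simp
  · have := hφ.le_slope_of_hasDerivAt hb ha h hd
    rw [slope_def_field, le_div_iff₀ (sub_pos.2 h)] at this
    linarith

theorem le_add_mul_sub_of_concaveOn {S : Set ℝ} {φ : ℝ → ℝ} {a b φ' : ℝ} (hφ : ConcaveOn ℝ S φ)
    (ha : a ∈ S) (hb : b ∈ S) (hd : HasDerivAt φ φ' b) : φ a ≤ φ b + φ' * (a - b) := by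
  have := add_mul_sub_le_of_convexOn hφ.neg ha hb hd.neg
  simp only [Pi.neg_apply] at this
  linarith

section PowerFunction

variable {p : ℝ}

theorem continuous_abs_rpow (hp : 0 ≤ p) : Continuous fun x : ℝ => |x| ^ p :=
  continuous_abs.rpow_const fun _ => Or.inr hp

theorem strictConvexOn_abs_rpow (hp : 1 < p) :
    StrictConvexOn ℝ Set.univ (fun x : ℝ => |x| ^ p) := by
  refine ⟨convex_univ, fun x _ y _ hxy a b ha hb hab => ?_⟩
  simp only [smul_eq_mul]
  by_cases hne : |x| = |y|
  · obtain rfl : x = -y := (abs_eq_abs.1 hne).resolve_left hxy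
    have hy : 0 < |y| := abs_pos.2 fun h0 => hxy (by simp [h0])
    have hlt : |a * -y + b * y| < |y| := by
      have hba : |b - a| < 1 := abs_lt.2 ⟨by linarith, by linarith⟩
      calc |a * -y + b * y| = |b - a| * |y| := by rw [← abs_mul]; ring_nf
        _ < |y| := mul_lt_of_lt_one_left hy hba
    calc |a * -y + b * y| ^ p < |y| ^ p := by gcongr
      _ = a * |-y| ^ p + b * |y| ^ p := by rw [hne, ← add_mul, hab, one_mul]
  · have htri : |a * x + b * y| ≤ a * |x| + b * |y| := by
      simpa only [abs_mul, abs_of_pos ha, abs_of_pos hb] using abs_add_le (a * x) (b * y)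
    calc |a * x + b * y| ^ p ≤ (a * |x| + b * |y|) ^ p := by gcongr
      _ < a * |x| ^ p + b * |y| ^ p :=
          (strictConvexOn_rpow hp).2 (abs_nonneg x) (abs_nonneg y) hne ha hb hab

theorem abs_lineMap_rpow_le (hp : 1 < p) (a b : ℝ) {θ : ℝ} (hθ : θ ∈ Set.Icc (0 : ℝ) 1) :
    |AffineMap.lineMap a b θ| ^ p ≤ |a| ^ p + |b| ^ p := by
  obtain ⟨h0, h1⟩ := hθ
  have hconv := (strictConvexOn_abs_rpow hp).convexOn.2 (Set.mem_univ a) (Set.mem_univ b)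
    (sub_nonneg.2 h1) h0 (sub_add_cancel 1 θ)
  rw [AffineMap.lineMap_apply_module]
  refine hconv.trans (add_le_add ?_ ?_)
  · exact mul_le_of_le_one_left (by positivity) (by linarith)
  · exact mul_le_of_le_one_left (by positivity) h1

theorem abs_sub_rpow_le (hp : 0 ≤ p) (a b : ℝ) :
    |a - b| ^ p ≤ 2 ^ p * (|a| ^ p + |b| ^ p) := by
  have hab : |a - b| ≤ 2 * max |a| |b| :=
    (abs_sub a b).trans
      (by linarith [le_max_left |a| |b|, le_max_right |a| |b|])
  have hmax : (max |a| |b|) ^ p ≤ |a| ^ p + |b| ^ p := by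
    have ha : 0 ≤ |a| ^ p := by positivity
    have hb : 0 ≤ |b| ^ p := by positivity
    rcases max_choice |a| |b| with h | h <;> rw [h] <;> linarith
  calc |a - b| ^ p ≤ (2 * max |a| |b|) ^ p := by gcongr
    _ = 2 ^ p * (max |a| |b|) ^ p := Real.mul_rpow zero_le_two (by positivity)
    _ ≤ 2 ^ p * (|a| ^ p + |b| ^ p) := by gcongr

/-- The nonlinearity `|a| ^ (p - 2) a` of the fractional `p`-Laplacian, i.e. the derivative of
`|a| ^ p / p`. -/
def flux (p a : ℝ) : ℝ := |a| ^ (p - 2) * a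

theorem flux_one_right (p : ℝ) : flux p 1 = 1 := by simp [flux]

theorem abs_flux (hp : 1 < p) (a : ℝ) : |flux p a| = |a| ^ (p - 1) := by
  rw [flux, abs_mul, Real.abs_rpow_of_nonneg (abs_nonneg a), abs_abs]
  rcases eq_or_ne a 0 with rfl | ha
  · simp [Real.zero_rpow (by linarith : p - 1 ≠ 0)]
  · rw [← Real.rpow_add_one (abs_ne_zero.2 ha)]
    ring_nf

theorem hasDerivAt_abs_rpow_flux (hp : 1 < p) (a : ℝ) :
    HasDerivAt (fun x : ℝ => |x| ^ p) (p * flux p a) a := by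
  simpa only [flux, mul_assoc] using hasDerivAt_abs_rpow a hp

theorem continuous_flux (hp : 1 < p) : Continuous (flux p) := by
  have hcont : Continuous fun x => p * flux p x := by
    rw [← funext fun x => (hasDerivAt_abs_rpow_flux hp x).deriv]
    exact (contDiff_norm_rpow hp).continuous_deriv le_rfl
  simpa [← mul_assoc, inv_mul_cancel₀ (by linarith : p ≠ 0)] using hcont.const_mul p⁻¹

theorem flux_mul_sub_le (hp : 1 < p) (a b : ℝ) :
    flux p a * (b - a) ≤ p⁻¹ * |b| ^ p - p⁻¹ * |a| ^ p := by
  have := add_mul_sub_le_of_convexOn (strictConvexOn_abs_rpow hp).convexOn (Set.mem_univ b)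
    (Set.mem_univ a) (hasDerivAt_abs_rpow_flux hp a)
  rw [← mul_sub, le_inv_mul_iff₀ (by linarith)]
  linarith

theorem abs_flux_mul_le (hp : 1 < p) {t : ℝ} (ht : 0 < t) (a b : ℝ) :
    |flux p a * b| ≤ t * |a| ^ p + t ^ (1 - p) * |b| ^ p := by
  have hpow : ∀ c : ℝ, |c| ^ (p - 1) * |c| = |c| ^ p := fun c => by
    rw [Real.rpow_sub_one' (abs_nonneg c) (by linarith), div_mul_cancel_of_imp]
    intro hc
    rw [hc, Real.zero_rpow (by linarith)]
  rw [abs_mul, abs_flux hp]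
  rcases le_total |b| (t * |a|) with h | h
  · calc |a| ^ (p - 1) * |b| ≤ |a| ^ (p - 1) * (t * |a|) := by gcongr
      _ = t * |a| ^ p := by rw [← hpow a]; ring
      _ ≤ t * |a| ^ p + t ^ (1 - p) * |b| ^ p := le_add_of_nonneg_right (by positivity)
  · have hab : |a| ≤ t⁻¹ * |b| := (le_inv_mul_iff₀ ht).2 h
    calc |a| ^ (p - 1) * |b| ≤ (t⁻¹ * |b|) ^ (p - 1) * |b| := by gcongr
      _ = t ^ (1 - p) * |b| ^ p := by
          rw [Real.mul_rpow (by positivity) (abs_nonneg b), Real.inv_rpow ht.le,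
            ← Real.rpow_neg ht.le, neg_sub, mul_assoc, hpow]
      _ ≤ t * |a| ^ p + t ^ (1 - p) * |b| ^ p := le_add_of_nonneg_left (by positivity)

theorem abs_le_add_rpow (hp : 1 < p) {t : ℝ} (ht : 0 < t) (b : ℝ) :
    |b| ≤ t + t ^ (1 - p) * |b| ^ p := by
  simpa [flux_one_right] using abs_flux_mul_le hp ht 1 b

/-- The convexity defect of `|x| ^ p` at the midpoint of `a` and `b`. It replaces Clarkson's
inequalities, which would need the cases `p ≤ 2` and `2 ≤ p` to be treated separately. -/
def midDefect (p a b : ℝ) : ℝ := (|a| ^ p + |b| ^ p) / 2 - |midpoint ℝ a b| ^ p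

theorem continuous_midDefect (hp : 0 ≤ p) : Continuous fun z : ℝ × ℝ => midDefect p z.1 z.2 := by
  have hc := continuous_abs_rpow hp
  exact (((hc.comp continuous_fst).add (hc.comp continuous_snd)).div_const 2).sub
    (hc.comp (continuous_fst.lineMap continuous_snd continuous_const))

theorem midDefect_pos (hp : 1 < p) {a b : ℝ} (hab : a ≠ b) : 0 < midDefect p a b := by
  have hconv := (strictConvexOn_abs_rpow hp).2 (Set.mem_univ a) (Set.mem_univ b) hab
    one_half_pos one_half_pos (add_halves 1)
  rw [midDefect, midpoint_eq_smul_add, invOf_eq_inv, ← one_div, smul_add, sub_pos]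
  exact hconv.trans_eq (by simp only [smul_eq_mul]; ring)

theorem midDefect_nonneg (hp : 1 < p) (a b : ℝ) : 0 ≤ midDefect p a b := by
  rcases eq_or_ne a b with rfl | h
  · simp [midDefect]
  · exact (midDefect_pos hp h).le

theorem midDefect_mul_mul (p r a b : ℝ) :
    midDefect p (r * a) (r * b) = |r| ^ p * midDefect p a b := by
  have hmid : midpoint ℝ (r * a) (r * b) = r * midpoint ℝ a b := by
    simp only [midpoint_eq_smul_add, smul_eq_mul]; ring
  simp only [midDefect, hmid, abs_mul, Real.mul_rpow (abs_nonneg _) (abs_nonneg _)]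
  ring

theorem exists_pos_le_midDefect_of_norm_eq_one (hp : 1 < p) {ε : ℝ} (hε : 0 < ε) :
    ∃ m : ℝ, 0 < m ∧ ∀ z : ℝ × ℝ, ‖z‖ = 1 →
      ε * (|z.1| ^ p + |z.2| ^ p) ≤ |z.1 - z.2| ^ p → m ≤ midDefect p z.1 z.2 := by
  have hp0 : 0 < p := by linarith
  have hc := continuous_abs_rpow hp0.le
  have hclosed : IsClosed {z : ℝ × ℝ | ε * (|z.1| ^ p + |z.2| ^ p) ≤ |z.1 - z.2| ^ p} :=
    isClosed_le (((hc.comp continuous_fst).add (hc.comp continuous_snd)).const_mul ε)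
      (hc.comp (continuous_fst.sub continuous_snd))
  have hpos : ∀ z ∈ Metric.sphere (0 : ℝ × ℝ) 1 ∩
      {z : ℝ × ℝ | ε * (|z.1| ^ p + |z.2| ^ p) ≤ |z.1 - z.2| ^ p}, 0 < midDefect p z.1 z.2 := by
    rintro ⟨a, b⟩ ⟨hz, hab⟩
    refine midDefect_pos hp fun heq : a = b => ?_
    subst heq
    have ha : 0 < |a| := by simp_all
    have : 0 < ε * (|a| ^ p + |a| ^ p) := by positivity
    simp only [Set.mem_ofPred_eq, sub_self, abs_zero, Real.zero_rpow hp0.ne'] at hab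
    linarith
  obtain ⟨m, hm, hmin⟩ := ((isCompact_sphere (0 : ℝ × ℝ) 1).inter_right hclosed).exists_forall_le'
    (continuous_midDefect hp0.le).continuousOn hpos
  exact ⟨m, hm, fun z hz hle => hmin z ⟨mem_sphere_zero_iff_norm.2 hz, hle⟩⟩

theorem exists_abs_sub_rpow_le_midDefect (hp : 1 < p) {ε : ℝ} (hε : 0 < ε) :
    ∃ C : ℝ, 0 ≤ C ∧ ∀ a b : ℝ,
      |a - b| ^ p ≤ ε * (|a| ^ p + |b| ^ p) + C * midDefect p a b := by
  have hp0 : 0 < p := by linarith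
  obtain ⟨m, hm, hmin⟩ := exists_pos_le_midDefect_of_norm_eq_one hp hε
  refine ⟨2 ^ p * m⁻¹, by positivity, fun a b => ?_⟩
  have hdef := midDefect_nonneg hp a b
  rcases le_total (|a - b| ^ p) (ε * (|a| ^ p + |b| ^ p)) with h | h
  · exact h.trans (le_add_of_nonneg_right (by positivity))
  rcases eq_or_ne (a, b) 0 with h0 | h0
  · obtain ⟨rfl, rfl⟩ : a = 0 ∧ b = 0 := by simpa using h0
    simp [midDefect, Real.zero_rpow hp0.ne']
  set r := ‖(a, b)‖
  have hr : 0 < r := norm_pos_iff.2 h0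
  -- By homogeneity the bound on the unit sphere becomes `m * r ^ p ≤ midDefect p a b`.
  have hscale : ∀ c : ℝ, |r⁻¹ * c| ^ p = (r ^ p)⁻¹ * |c| ^ p := fun c => by
    rw [abs_mul, abs_of_pos (inv_pos.2 hr), Real.mul_rpow (by positivity) (abs_nonneg c),
      Real.inv_rpow hr.le]
  have hunit : m ≤ midDefect p (r⁻¹ * a) (r⁻¹ * b) := by
    refine hmin (r⁻¹ * a, r⁻¹ * b) ?_ ?_
    · rw [show (r⁻¹ * a, r⁻¹ * b) = r⁻¹ • (a, b) from rfl, norm_smul, norm_inv, norm_norm,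
        inv_mul_cancel₀ hr.ne']
    · simp only [← mul_sub, hscale, ← mul_add]
      rw [mul_left_comm]
      gcongr
  have hmr : r ^ p ≤ m⁻¹ * midDefect p a b := by
    rw [midDefect_mul_mul, abs_of_pos (inv_pos.2 hr), Real.inv_rpow hr.le,
      le_inv_mul_iff₀ (by positivity)] at hunit
    rwa [le_inv_mul_iff₀ hm, mul_comm]
  have hab : |a - b| ≤ 2 * r := by
    have := norm_fst_le (a, b)
    have := norm_snd_le (a, b)
    have := abs_sub a b
    simp only [Real.norm_eq_abs] at *
    linarith
  calc |a - b| ^ p ≤ (2 * r) ^ p := by gcongr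
    _ = 2 ^ p * r ^ p := Real.mul_rpow zero_le_two hr.le
    _ ≤ 2 ^ p * (m⁻¹ * midDefect p a b) := by gcongr
    _ = 2 ^ p * m⁻¹ * midDefect p a b := (mul_assoc _ _ _).symm
    _ ≤ ε * (|a| ^ p + |b| ^ p) + 2 ^ p * m⁻¹ * midDefect p a b :=
        le_add_of_nonneg_left (by positivity)

end PowerFunction

/-! ### Convergence in `L^p` -/

theorem tendsto_zero_of_forall_le_mul_add {ι : Type*} {l : Filter ι} {x y : ι → ℝ} {R : ℝ}
    (hx : ∀ i, 0 ≤ x i) (hy : Tendsto y l (𝓝 0))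
    (h : ∀ ε > 0, ∃ C, ∀ᶠ i in l, x i ≤ ε * R + C * y i) : Tendsto x l (𝓝 0) := by
  refine Metric.tendsto_nhds.2 fun ε hε => ?_
  obtain ⟨C, hC⟩ := h (ε / 2 / (|R| + 1)) (by positivity)
  have hR : ε / 2 / (|R| + 1) * R ≤ ε / 2 := by
    rw [div_mul_eq_mul_div, div_le_iff₀ (by positivity)]
    gcongr
    linarith [le_abs_self R]
  have hCy : Tendsto (fun i => C * y i) l (𝓝 0) := by simpa using hy.const_mul C
  filter_upwards [hC, hCy.eventually_lt_const (half_pos hε)] with i hi hyi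
  rw [Real.dist_0_eq_abs, abs_of_nonneg (hx i)]
  linarith

section Lp

variable {Y E ι : Type*} [MeasurableSpace Y] {μ : Measure Y} [NormedAddCommGroup E]
  {p : ℝ} {q : ℝ≥0∞} {v w : Y → ℝ}

theorem memLp_ofReal_iff (hp : 0 < p) (hw : AEStronglyMeasurable w μ) :
    MemLp w (ENNReal.ofReal p) μ ↔ Integrable (fun z => |w z| ^ p) μ := by
  rw [← integrable_norm_rpow_iff hw (ENNReal.ofReal_pos.2 hp).ne' ENNReal.ofReal_ne_top,
    ENNReal.toReal_ofReal hp.le]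
  rfl

theorem memLp_of_memLp_restrict {F : Y → E} {S : Set Y} (hS : MeasurableSet S)
    (hF : MemLp F q (μ.restrict S)) (hF' : MemLp F q (μ.restrict Sᶜ)) : MemLp F q μ := by
  rw [← Set.indicator_self_add_compl S F]
  exact ((memLp_indicator_iff_restrict hS).2 hF).add ((memLp_indicator_iff_restrict hS.compl).2 hF')

theorem integrable_abs_rpow (hp : 0 < p) (hw : MemLp w (ENNReal.ofReal p) μ) :
    Integrable (fun z => |w z| ^ p) μ :=
  (memLp_ofReal_iff hp hw.1).1 hw

theorem integrable_midDefect (hp : 0 < p) (hv : MemLp v (ENNReal.ofReal p) μ)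
    (hw : MemLp w (ENNReal.ofReal p) μ) : Integrable (fun z => midDefect p (v z) (w z)) μ := by
  have hmid : MemLp (fun z => midpoint ℝ (v z) (w z)) (ENNReal.ofReal p) μ := by
    simp only [midpoint_eq_smul_add]
    exact (hv.add hw).const_smul (⅟2 : ℝ)
  exact (((integrable_abs_rpow hp hv).add (integrable_abs_rpow hp hw)).div_const 2).sub
    (integrable_abs_rpow hp hmid)

theorem integrable_flux_mul (hp : 1 < p) (hv : MemLp v (ENNReal.ofReal p) μ)
    (hw : MemLp w (ENNReal.ofReal p) μ) : Integrable (fun z => flux p (v z) * w z) μ := by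
  have hp0 := zero_lt_one.trans hp
  refine ((integrable_abs_rpow hp0 hv).add (integrable_abs_rpow hp0 hw)).mono'
    (((continuous_flux hp).comp_aestronglyMeasurable hv.1).mul hw.1) (.of_forall fun z => ?_)
  simpa using abs_flux_mul_le hp one_pos (v z) (w z)

theorem tendsto_eLpNorm_zero_iff_tendsto_integral (hp : 0 < p) {l : Filter ι} {F : ι → Y → ℝ}
    (hF : ∀ i, MemLp (F i) (ENNReal.ofReal p) μ) :
    Tendsto (fun i => eLpNorm (F i) (ENNReal.ofReal p) μ) l (𝓝 0) ↔
      Tendsto (fun i => ∫ z, |F i z| ^ p ∂μ) l (𝓝 0) := by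
  have hint_nonneg : ∀ i, 0 ≤ ∫ z, |F i z| ^ p ∂μ := fun i => integral_nonneg fun z => by positivity
  have hnorm : ∀ i, eLpNorm (F i) (ENNReal.ofReal p) μ =
      ENNReal.ofReal ((∫ z, |F i z| ^ p ∂μ) ^ p⁻¹) := fun i => by
    rw [(hF i).eLpNorm_eq_integral_rpow_norm (ENNReal.ofReal_pos.2 hp).ne' ENNReal.ofReal_ne_top,
      ENNReal.toReal_ofReal hp.le]
    rfl
  simp only [hnorm]
  refine ⟨fun h => ?_, fun h => ?_⟩
  · have hroot : Tendsto (fun i => (∫ z, |F i z| ^ p ∂μ) ^ p⁻¹) l (𝓝 0) :=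
      (ENNReal.tendsto_toReal ENNReal.zero_ne_top).comp h |>.congr fun i =>
        ENNReal.toReal_ofReal (Real.rpow_nonneg (hint_nonneg i) _)
    simpa only [Real.rpow_inv_rpow (hint_nonneg _) hp.ne', Real.zero_rpow hp.ne'] using
      hroot.rpow_const (Or.inr hp.le)
  · simpa only [Real.zero_rpow (inv_ne_zero hp.ne'), ENNReal.ofReal_zero] using
      ENNReal.tendsto_ofReal (h.rpow_const (Or.inr (inv_nonneg.2 hp.le)))

theorem exists_memLp_tendsto_eLpNorm_sub [CompleteSpace E] (hq : 1 ≤ q) {w : ℕ → Y → E}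
    (hw : ∀ k, MemLp (w k) q μ)
    (hc : Tendsto (fun kl : ℕ × ℕ => eLpNorm (w kl.1 - w kl.2) q μ) atTop (𝓝 0)) :
    ∃ u, MemLp u q μ ∧ Tendsto (fun k => eLpNorm (w k - u) q μ) atTop (𝓝 0) := by
  have : Fact (1 ≤ q) := ⟨hq⟩
  have hcauchy : CauchySeq fun k => (hw k).toLp (w k) := by
    refine cauchySeq_iff_tendsto_dist_atTop_0.2 ?_
    simp only [dist_edist, Lp.edist_toLp_toLp]
    exact (ENNReal.tendsto_toReal ENNReal.zero_ne_top).comp hc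
  obtain ⟨U, hU⟩ := cauchySeq_tendsto_of_complete hcauchy
  rw [← Lp.toLp_coeFn U (Lp.memLp U)] at hU
  exact ⟨U, Lp.memLp U, (Lp.tendsto_Lp_iff_tendsto_eLpNorm'' w hw U (Lp.memLp U)).1 hU⟩

theorem exists_seq_tendsto_ae_of_tendsto_eLpNorm (hq : q ≠ 0) {w : ℕ → Y → E} {u : Y → E}
    (hw : ∀ k, MemLp (w k) q μ) (hu : MemLp u q μ)
    (h : Tendsto (fun k => eLpNorm (w k - u) q μ) atTop (𝓝 0)) :
    ∃ ns : ℕ → ℕ, StrictMono ns ∧ ∀ᵐ z ∂μ, Tendsto (fun k => w (ns k) z) atTop (𝓝 (u z)) :=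
  (tendstoInMeasure_of_tendsto_eLpNorm hq (fun k => (hw k).1) hu.1 h).exists_seq_tendsto_ae

theorem memLp_and_tendsto_eLpNorm_of_tendsto_ae [CompleteSpace E] (hq : 1 ≤ q) {w : ℕ → Y → E}
    {u : Y → E} {ns : ℕ → ℕ} (hw : ∀ k, MemLp (w k) q μ)
    (hc : Tendsto (fun kl : ℕ × ℕ => eLpNorm (w kl.1 - w kl.2) q μ) atTop (𝓝 0))
    (hns : StrictMono ns) (hlim : ∀ᵐ z ∂μ, Tendsto (fun k => w (ns k) z) atTop (𝓝 (u z))) :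
    MemLp u q μ ∧ Tendsto (fun k => eLpNorm (w k - u) q μ) atTop (𝓝 0) := by
  obtain ⟨U, hU, hUlim⟩ := exists_memLp_tendsto_eLpNorm_sub hq hw hc
  obtain ⟨ms, hms, hmslim⟩ := exists_seq_tendsto_ae_of_tendsto_eLpNorm
    (zero_lt_one.trans_le hq).ne' (fun k => hw (ns k)) hU (hUlim.comp hns.tendsto_atTop)
  have hUu : U =ᵐ[μ] u := by
    filter_upwards [hlim, hmslim] with z hz hz'
    exact tendsto_nhds_unique hz' (hz.comp hms.tendsto_atTop)
  exact ⟨hU.ae_eq hUu, hUlim.congr fun k => eLpNorm_congr_ae (EventuallyEq.rfl.sub hUu)⟩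

end Lp

/-! ### Bounded nonincreasing nonlinearities -/

section Forcing

variable {X Y : Type*} [MeasurableSpace X] {ν : Measure X} {φ : X → ℝ → ℝ} {M : ℝ≥0}

/-- Lower-order terms `φ ξ x` that are jointly measurable, continuous and nonincreasing in `x` for
every `ξ`, and bounded by `M`. Asking this for every `ξ` and not only almost everywhere loses
nothing by `exists_isBoundedForcing`. -/
structure IsBoundedForcing (φ : X → ℝ → ℝ) (M : ℝ≥0) : Prop where
  measurable : Measurable (Function.uncurry φ)
  continuous : ∀ ξ, Continuous (φ ξ)
  antitone : ∀ ξ, Antitone (φ ξ)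
  abs_le : ∀ ξ x, |φ ξ x| ≤ M

/-- The primitive `∫₀ˣ φ ξ τ dτ` of the lower-order term, the potential through which it enters the
energy. -/
def primitive (φ : X → ℝ → ℝ) (ξ : X) (x : ℝ) : ℝ := ∫ τ in (0 : ℝ)..x, φ ξ τ

theorem IsBoundedForcing.hasDerivAt_primitive (hφ : IsBoundedForcing φ M) (ξ : X) (x : ℝ) :
    HasDerivAt (primitive φ ξ) (φ ξ x) x :=
  ((hφ.continuous ξ).integral_hasStrictDerivAt 0 x).hasDerivAt

theorem IsBoundedForcing.concaveOn_primitive (hφ : IsBoundedForcing φ M) (ξ : X) :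
    ConcaveOn ℝ Set.univ (primitive φ ξ) := by
  refine Antitone.concaveOn_univ_of_deriv
    (fun x => (hφ.hasDerivAt_primitive ξ x).differentiableAt) ?_
  rw [funext fun x => (hφ.hasDerivAt_primitive ξ x).deriv]
  exact hφ.antitone ξ

theorem IsBoundedForcing.primitive_le (hφ : IsBoundedForcing φ M) (ξ : X) (a b : ℝ) :
    primitive φ ξ b ≤ primitive φ ξ a + φ ξ a * (b - a) :=
  le_add_mul_sub_of_concaveOn (hφ.concaveOn_primitive ξ) (Set.mem_univ b) (Set.mem_univ a)
    (hφ.hasDerivAt_primitive ξ a)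

theorem IsBoundedForcing.abs_primitive_le (hφ : IsBoundedForcing φ M) (ξ : X) (a : ℝ) :
    |primitive φ ξ a| ≤ M * |a| := by
  simpa only [primitive, Real.norm_eq_abs, sub_zero] using
    intervalIntegral.norm_integral_le_of_norm_le_const (f := φ ξ) (a := 0) (b := a)
      fun x _ => hφ.abs_le ξ x

theorem IsBoundedForcing.measurable_primitive (hφ : IsBoundedForcing φ M) :
    Measurable (Function.uncurry (primitive φ)) := by
  -- The substitution `τ = x σ` makes the domain of integration independent of `x`.
  have hsubst : Function.uncurry (primitive φ) = fun z : X × ℝ =>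
      z.2 * ∫ σ in Set.Ioc (0 : ℝ) 1, φ z.1 (z.2 * σ) := by
    ext z
    rw [← intervalIntegral.integral_of_le zero_le_one,
      intervalIntegral.mul_integral_comp_mul_left (f := φ z.1) z.2, mul_zero, mul_one]
    rfl
  have hmeas : Measurable fun y : (X × ℝ) × ℝ => φ y.1.1 (y.1.2 * y.2) :=
    hφ.measurable.comp (measurable_fst.fst.prodMk (measurable_fst.snd.mul measurable_snd))
  rw [hsubst]
  exact measurable_snd.mul hmeas.stronglyMeasurable.integral_prod_right.measurable

theorem IsBoundedForcing.aestronglyMeasurable_comp (hφ : IsBoundedForcing φ M) {u : X → ℝ}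
    (hu : AEStronglyMeasurable u ν) : AEStronglyMeasurable (fun ξ => φ ξ (u ξ)) ν :=
  (hφ.measurable.comp_aemeasurable (aemeasurable_id.prodMk hu.aemeasurable)).aestronglyMeasurable

theorem IsBoundedForcing.integrable_mul (hφ : IsBoundedForcing φ M) {u v : X → ℝ}
    (hu : AEStronglyMeasurable u ν) (hv : Integrable v ν) :
    Integrable (fun ξ => φ ξ (u ξ) * v ξ) ν :=
  hv.bdd_mul (hφ.aestronglyMeasurable_comp hu) (.of_forall fun ξ => hφ.abs_le ξ (u ξ))

theorem IsBoundedForcing.integrable_primitive (hφ : IsBoundedForcing φ M) {u : X → ℝ}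
    (hu : Integrable u ν) : Integrable (fun ξ => primitive φ ξ (u ξ)) ν :=
  (hu.abs.const_mul (M : ℝ)).mono'
    (hφ.measurable_primitive.comp_aemeasurable
      (aemeasurable_id.prodMk hu.aemeasurable)).aestronglyMeasurable
    (.of_forall fun ξ => hφ.abs_primitive_le ξ (u ξ))

theorem ae_forall_mem_of_isClosed [TopologicalSpace Y] [TopologicalSpace.SeparableSpace Y]
    {S : X → Set Y} (hcl : ∀ᵐ ξ ∂ν, IsClosed (S ξ)) (hS : ∀ y, ∀ᵐ ξ ∂ν, y ∈ S ξ) :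
    ∀ᵐ ξ ∂ν, ∀ y, y ∈ S ξ := by
  obtain ⟨D, hDc, hD⟩ := TopologicalSpace.exists_countable_dense Y
  filter_upwards [hcl, (ae_ball_iff hDc).2 fun y _ => hS y] with ξ hξ hDξ y
  exact hξ.closure_subset_iff.2 (fun y hy => hDξ y hy) (hD y)

theorem exists_measurable_uncurry_ae_eq {f : X → ℝ → ℝ} {P : (ℝ → ℝ) → Prop}
    (hmeas : ∀ x, AEMeasurable (fun ξ => f ξ x) ν) (hcont : ∀ g, P g → Continuous g)
    (hP : ∀ᵐ ξ ∂ν, P (f ξ)) (hP0 : P 0) :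
    ∃ φ : X → ℝ → ℝ, Measurable (Function.uncurry φ) ∧ (∀ ξ, P (φ ξ)) ∧ φ =ᵐ[ν] f := by
  have hmk : ∀ᵐ ξ ∂ν, ∀ r : ℚ, f ξ r = (hmeas r).mk _ ξ := ae_all_iff.2 fun r => (hmeas r).ae_eq_mk
  obtain ⟨T, hTae, hTm, hT⟩ := (hP.and hmk).exists_measurable_mem
  have hPφ : ∀ ξ, P (T.indicator f ξ) := fun ξ => by
    by_cases h : ξ ∈ T
    · simpa only [Set.indicator_of_mem h] using (hT ξ h).1
    · simpa only [Set.indicator_of_notMem h] using hP0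
  have hrat : ∀ r : ℚ, Measurable fun ξ => T.indicator f ξ r := fun r => by
    convert (hmeas r).measurable_mk.indicator hTm using 2 with ξ
    by_cases h : ξ ∈ T
    · simp only [Set.indicator_of_mem h, (hT ξ h).2 r]
    · simp only [Set.indicator_of_notMem h, Pi.zero_apply]
  have hreal : ∀ x : ℝ, Measurable fun ξ => T.indicator f ξ x := fun x => by
    obtain ⟨a, ha, hax⟩ := mem_closure_iff_seq_limit.1 (Rat.denseRange_cast (𝕜 := ℝ) x)
    choose r hr using ha
    refine measurable_of_tendsto_metrizable (fun k => hrat (r k)) (tendsto_pi_nhds.2 fun ξ => ?_)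
    simp only [hr]
    exact ((hcont _ (hPφ ξ)).tendsto x).comp hax
  refine ⟨T.indicator f, ?_, hPφ, ?_⟩
  · exact (measurable_uncurry_of_continuous_of_measurable (u := fun x ξ => T.indicator f ξ x)
      (fun ξ => hcont _ (hPφ ξ)) hreal).comp measurable_swap
  · filter_upwards [hTae] with ξ hξ using Set.indicator_of_mem hξ f

theorem exists_isBoundedForcing {f : X → ℝ → ℝ} {M : ℝ}
    (hmeas : ∀ x, AEMeasurable (fun ξ => f ξ x) ν) (hcont : ∀ᵐ ξ ∂ν, Continuous (f ξ))
    (hbdd : ∀ x, ∀ᵐ ξ ∂ν, |f ξ x| ≤ M)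
    (hmono : ∀ x₁ x₂, ∀ᵐ ξ ∂ν, (f ξ x₁ - f ξ x₂) * (x₁ - x₂) ≤ 0) :
    ∃ φ : X → ℝ → ℝ, IsBoundedForcing φ M.toNNReal ∧ φ =ᵐ[ν] f := by
  have hbdd' : ∀ᵐ ξ ∂ν, ∀ x, |f ξ x| ≤ M.toNNReal :=
    ae_forall_mem_of_isClosed (S := fun ξ => {x | |f ξ x| ≤ M.toNNReal})
      (hcont.mono fun ξ hξ => isClosed_le hξ.abs continuous_const)
      fun x => (hbdd x).mono fun ξ hξ => hξ.trans (Real.le_coe_toNNReal M)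
  have hmono' : ∀ᵐ ξ ∂ν, ∀ x : ℝ × ℝ, (f ξ x.1 - f ξ x.2) * (x.1 - x.2) ≤ 0 :=
    ae_forall_mem_of_isClosed (S := fun ξ => {x : ℝ × ℝ | (f ξ x.1 - f ξ x.2) * (x.1 - x.2) ≤ 0})
      (hcont.mono fun ξ hξ => isClosed_le (by fun_prop) continuous_const) fun x => hmono x.1 x.2
  have hanti : ∀ᵐ ξ ∂ν, Antitone (f ξ) := hmono'.mono fun ξ hξ =>
    antivary_id_iff.1 (antivary_iff_forall_mul_nonpos.2 fun i j => hξ (j, i))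
  obtain ⟨φ, hφm, hφ, hφf⟩ := exists_measurable_uncurry_ae_eq
    (P := fun g => Continuous g ∧ Antitone g ∧ ∀ x, |g x| ≤ M.toNNReal) hmeas (fun g hg => hg.1)
    (hcont.and (hanti.and hbdd')) ⟨continuous_const, antitone_const, fun x => by simp⟩
  exact ⟨φ, ⟨hφm, fun ξ => (hφ ξ).1, fun ξ => (hφ ξ).2.1, fun ξ => (hφ ξ).2.2⟩, hφf⟩

end Forcing

/-! ### The energy and its first variation -/

section LpEstimates

variable {Y : Type*} [MeasurableSpace Y] {μ : Measure Y} {p : ℝ} {u v w : Y → ℝ}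

theorem integral_flux_mul_sub_le (hp : 1 < p) (hu : MemLp u (ENNReal.ofReal p) μ)
    (hv : MemLp v (ENNReal.ofReal p) μ) :
    ∫ z, flux p (u z) * (v - u) z ∂μ ≤ p⁻¹ * ∫ z, |v z| ^ p ∂μ - p⁻¹ * ∫ z, |u z| ^ p ∂μ := by
  have hp0 := zero_lt_one.trans hp
  have hu' := (integrable_abs_rpow hp0 hu).const_mul p⁻¹
  have hv' := (integrable_abs_rpow hp0 hv).const_mul p⁻¹
  rw [← integral_const_mul, ← integral_const_mul, ← integral_sub hv' hu']
  exact integral_mono (integrable_flux_mul hp hu (hv.sub hu)) (hv'.sub hu')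
    fun z => flux_mul_sub_le hp (u z) (v z)

theorem abs_integral_flux_mul_le (hp : 1 < p) {t : ℝ} (ht : 0 < t)
    (hu : MemLp u (ENNReal.ofReal p) μ) (hv : MemLp v (ENNReal.ofReal p) μ) :
    |∫ z, flux p (u z) * v z ∂μ| ≤ t * ∫ z, |u z| ^ p ∂μ + t ^ (1 - p) * ∫ z, |v z| ^ p ∂μ := by
  have hp0 := zero_lt_one.trans hp
  have hu' := (integrable_abs_rpow hp0 hu).const_mul t
  have hv' := (integrable_abs_rpow hp0 hv).const_mul (t ^ (1 - p))
  rw [← integral_const_mul, ← integral_const_mul, ← integral_add hu' hv']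
  exact abs_integral_le_integral_abs.trans <| integral_mono (integrable_flux_mul hp hu hv).abs
    (hu'.add hv') fun z => abs_flux_mul_le hp ht (u z) (v z)

theorem integral_abs_sub_rpow_le (hp : 0 < p) (hu : MemLp u (ENNReal.ofReal p) μ)
    (hv : MemLp v (ENNReal.ofReal p) μ) :
    ∫ z, |(u - v) z| ^ p ∂μ ≤ 2 ^ p * (∫ z, |u z| ^ p ∂μ + ∫ z, |v z| ^ p ∂μ) := by
  have hu' := integrable_abs_rpow hp hu
  have hv' := integrable_abs_rpow hp hv
  rw [← integral_add hu' hv', ← integral_const_mul]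
  exact integral_mono (integrable_abs_rpow hp (hu.sub hv)) ((hu'.add hv').const_mul _)
    fun z => abs_sub_rpow_le hp.le (u z) (v z)

theorem integral_midDefect (hp : 0 < p) (hu : MemLp u (ENNReal.ofReal p) μ)
    (hv : MemLp v (ENNReal.ofReal p) μ) :
    ∫ z, midDefect p (u z) (v z) ∂μ =
      (∫ z, |u z| ^ p ∂μ + ∫ z, |v z| ^ p ∂μ) / 2 - ∫ z, |midpoint ℝ u v z| ^ p ∂μ := by
  have hu' := integrable_abs_rpow hp hu
  have hv' := integrable_abs_rpow hp hv
  have hmid : MemLp (midpoint ℝ u v) (ENNReal.ofReal p) μ := by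
    rw [midpoint_eq_smul_add]
    exact (hu.add hv).const_smul _
  have huv : Integrable (fun z => (|u z| ^ p + |v z| ^ p) / 2) μ := (hu'.add hv').div_const 2
  rw [← integral_add hu' hv', ← integral_div,
    ← integral_sub huv (integrable_abs_rpow hp hmid)]
  simp only [midDefect, pi_midpoint_apply]

theorem exists_integral_abs_sub_rpow_le_midDefect (hp : 1 < p) {ε : ℝ} (hε : 0 < ε) :
    ∃ C : ℝ, 0 ≤ C ∧ ∀ u v : Y → ℝ, MemLp u (ENNReal.ofReal p) μ → MemLp v (ENNReal.ofReal p) μ →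
      ∫ z, |(u - v) z| ^ p ∂μ ≤
        ε * (∫ z, |u z| ^ p ∂μ + ∫ z, |v z| ^ p ∂μ) + C * ∫ z, midDefect p (u z) (v z) ∂μ := by
  have hp0 := zero_lt_one.trans hp
  obtain ⟨C, hC, h⟩ := exists_abs_sub_rpow_le_midDefect hp hε
  refine ⟨C, hC, fun u v hu hv => ?_⟩
  have hu' := integrable_abs_rpow hp0 hu
  have hv' := integrable_abs_rpow hp0 hv
  have hd := (integrable_midDefect hp0 hu hv).const_mul C
  have hS : Integrable (fun z => ε * (|u z| ^ p + |v z| ^ p)) μ := (hu'.add hv').const_mul ε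
  rw [← integral_add hu' hv', ← integral_const_mul, ← integral_const_mul, ← integral_add hS hd]
  exact integral_mono (integrable_abs_rpow hp0 (hu.sub hv)) (hS.add hd) fun z => h (u z) (v z)

theorem tendsto_integral_flux_lineMap_mul (hp : 1 < p) (hu : MemLp u (ENNReal.ofReal p) μ)
    (hv : MemLp v (ENNReal.ofReal p) μ) (hw : MemLp w (ENNReal.ofReal p) μ) :
    Tendsto (fun θ : ℝ => ∫ z, flux p (AffineMap.lineMap u v θ z) * w z ∂μ) (𝓝[>] 0)
      (𝓝 (∫ z, flux p (u z) * w z ∂μ)) := by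
  have hp0 := zero_lt_one.trans hp
  have hseg : ∀ θ : ℝ, MemLp (AffineMap.lineMap u v θ) (ENNReal.ofReal p) μ := fun θ => by
    rw [AffineMap.lineMap_apply_module']
    exact ((hv.sub hu).const_smul θ).add hu
  refine tendsto_integral_filter_of_dominated_convergence
    (fun z => |u z| ^ p + |v z| ^ p + |w z| ^ p)
    (.of_forall fun θ => (integrable_flux_mul hp (hseg θ) hw).1) ?_
    (((integrable_abs_rpow hp0 hu).add (integrable_abs_rpow hp0 hv)).add
      (integrable_abs_rpow hp0 hw)) (.of_forall fun z => ?_)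
  · filter_upwards [Ioc_mem_nhdsGT one_pos] with θ hθ
    refine .of_forall fun z => ?_
    have hflux := abs_flux_mul_le hp one_pos (AffineMap.lineMap u v θ z) (w z)
    have hlineMap := abs_lineMap_rpow_le hp (u z) (v z) (Set.Ioc_subset_Icc_self hθ)
    rw [one_mul, Real.one_rpow, one_mul, AffineMap.pi_lineMap_apply] at hflux
    rw [Real.norm_eq_abs, AffineMap.pi_lineMap_apply]
    linarith
  · have hcont : Continuous fun θ : ℝ => flux p (AffineMap.lineMap (u z) (v z) θ) * w z :=
      ((continuous_flux hp).comp AffineMap.lineMap_continuous).mul_const _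
    simpa only [AffineMap.pi_lineMap_apply, AffineMap.lineMap_apply_zero] using
      (hcont.tendsto 0).mono_left nhdsWithin_le_nhds

end LpEstimates

section ForcingEstimates

variable {X : Type*} [MeasurableSpace X] {ν ρ : Measure X} {φ : X → ℝ → ℝ} {M : ℝ≥0} {p : ℝ}
  {u v w : X → ℝ}

theorem IsBoundedForcing.integral_primitive_le (hφ : IsBoundedForcing φ M) (hu : Integrable u ρ)
    (hv : Integrable v ρ) :
    ∫ ξ, primitive φ ξ (v ξ) ∂ρ ≤
      ∫ ξ, primitive φ ξ (u ξ) ∂ρ + ∫ ξ, φ ξ (u ξ) * (v - u) ξ ∂ρ := by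
  have hu' := hφ.integrable_primitive hu
  have hd := hφ.integrable_mul hu.1 (hv.sub hu)
  rw [← integral_add hu' hd]
  exact integral_mono (hφ.integrable_primitive hv) (hu'.add hd)
    fun ξ => hφ.primitive_le ξ (u ξ) (v ξ)

theorem IsBoundedForcing.le_integral_primitive_midpoint (hφ : IsBoundedForcing φ M)
    (hu : Integrable u ρ) (hv : Integrable v ρ) :
    (∫ ξ, primitive φ ξ (u ξ) ∂ρ + ∫ ξ, primitive φ ξ (v ξ) ∂ρ) / 2 ≤
      ∫ ξ, primitive φ ξ (midpoint ℝ u v ξ) ∂ρ := by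
  have hmid : Integrable (midpoint ℝ u v) ρ := by
    rw [midpoint_eq_smul_add]
    exact (hu.add hv).smul _
  have hu' := hφ.integrable_primitive hu
  have hv' := hφ.integrable_primitive hv
  rw [← integral_add hu' hv', ← integral_div]
  refine integral_mono ((hu'.add hv').div_const 2) (hφ.integrable_primitive hmid) fun ξ => ?_
  have hconc := (hφ.concaveOn_primitive ξ).2 (Set.mem_univ (u ξ)) (Set.mem_univ (v ξ))
    (one_half_pos (α := ℝ)).le (one_half_pos (α := ℝ)).le (add_halves 1)
  rw [← smul_add, ← smul_add, smul_eq_mul] at hconc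
  rw [pi_midpoint_apply, midpoint_eq_smul_add, invOf_eq_inv, div_eq_inv_mul, ← one_div]
  exact hconc

theorem IsBoundedForcing.tendsto_integral_lineMap_mul (hφ : IsBoundedForcing φ M)
    (hu : AEStronglyMeasurable u ρ) (hv : AEStronglyMeasurable v ρ) (hw : Integrable w ρ) :
    Tendsto (fun θ : ℝ => ∫ ξ, φ ξ (AffineMap.lineMap u v θ ξ) * w ξ ∂ρ) (𝓝[>] 0)
      (𝓝 (∫ ξ, φ ξ (u ξ) * w ξ ∂ρ)) := by
  have hseg : ∀ θ : ℝ, AEStronglyMeasurable (AffineMap.lineMap u v θ) ρ := fun θ => by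
    rw [AffineMap.lineMap_apply_module']
    exact ((hv.sub hu).const_smul θ).add hu
  refine tendsto_integral_filter_of_dominated_convergence (fun ξ => M * |w ξ|)
    (.of_forall fun θ => (hφ.integrable_mul (hseg θ) hw).1) (.of_forall fun θ => ?_)
    (hw.abs.const_mul _) (.of_forall fun ξ => ?_)
  · refine .of_forall fun ξ => ?_
    rw [Real.norm_eq_abs, abs_mul]
    exact mul_le_mul_of_nonneg_right (hφ.abs_le ξ _) (abs_nonneg _)
  · have hcont : Continuous fun θ : ℝ => φ ξ (AffineMap.lineMap (u ξ) (v ξ) θ) * w ξ :=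
      ((hφ.continuous ξ).comp AffineMap.lineMap_continuous).mul_const _
    simpa only [AffineMap.pi_lineMap_apply, AffineMap.lineMap_apply_zero] using
      (hcont.tendsto 0).mono_left nhdsWithin_le_nhds

theorem integrable_of_memLp_of_le [IsFiniteMeasure ρ] (hp : 1 ≤ p) (hρ : ρ ≤ ν)
    (hw : MemLp w (ENNReal.ofReal p) ν) : Integrable w ρ :=
  (hw.mono_measure hρ).integrable (ENNReal.one_le_ofReal.2 hp)

theorem integral_abs_le_add_integral_rpow [IsFiniteMeasure ρ] (hp : 1 < p) (hρ : ρ ≤ ν) {t : ℝ}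
    (ht : 0 < t) (hw : MemLp w (ENNReal.ofReal p) ν) :
    ∫ ξ, |w ξ| ∂ρ ≤ t * ρ.real Set.univ + t ^ (1 - p) * ∫ ξ, |w ξ| ^ p ∂ν := by
  have hw' := integrable_abs_rpow (zero_lt_one.trans hp) hw
  have hwρ := (hw'.mono_measure hρ).const_mul (t ^ (1 - p))
  calc ∫ ξ, |w ξ| ∂ρ ≤ ∫ ξ, (t + t ^ (1 - p) * |w ξ| ^ p) ∂ρ :=
        integral_mono (integrable_of_memLp_of_le hp.le hρ hw).abs ((integrable_const t).add hwρ)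
          fun ξ => abs_le_add_rpow hp ht (w ξ)
    _ = t * ρ.real Set.univ + t ^ (1 - p) * ∫ ξ, |w ξ| ^ p ∂ρ := by
        rw [integral_add (integrable_const t) hwρ, integral_const, integral_const_mul, smul_eq_mul,
          mul_comm t]
    _ ≤ _ := by
        gcongr
        exact .of_forall fun ξ => by positivity

theorem IsBoundedForcing.abs_integral_mul_le [IsFiniteMeasure ρ] (hφ : IsBoundedForcing φ M)
    (hp : 1 < p) (hρ : ρ ≤ ν) {t : ℝ} (ht : 0 < t) (hu : AEStronglyMeasurable u ρ)
    (hv : MemLp v (ENNReal.ofReal p) ν) :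
    |∫ ξ, φ ξ (u ξ) * v ξ ∂ρ| ≤
      M * (t * ρ.real Set.univ + t ^ (1 - p) * ∫ ξ, |v ξ| ^ p ∂ν) := by
  have hv' := integrable_of_memLp_of_le hp.le hρ hv
  calc |∫ ξ, φ ξ (u ξ) * v ξ ∂ρ| ≤ ∫ ξ, M * |v ξ| ∂ρ :=
        abs_integral_le_integral_abs.trans <| integral_mono (hφ.integrable_mul hu hv').abs
          (hv'.abs.const_mul _) fun ξ => by
            rw [abs_mul]
            exact mul_le_mul_of_nonneg_right (hφ.abs_le ξ _) (abs_nonneg _)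
    _ ≤ _ := by
        rw [integral_const_mul]
        gcongr
        exact integral_abs_le_add_integral_rpow hp hρ ht hv

end ForcingEstimates

section Energy

variable {X : Type*}

/-- The increment `u ξ - u η` at `z = (ξ, η)`, as a linear map in `u`. -/
def incr : (X → ℝ) →ₗ[ℝ] (X × X → ℝ) where
  toFun u z := u z.1 - u z.2
  map_add' u v := by ext z; simp only [Pi.add_apply]; ring
  map_smul' c u := by ext z; simp only [Pi.smul_apply, smul_eq_mul, RingHom.id_apply]; ring

theorem incr_apply (u : X → ℝ) (z : X × X) : incr u z = u z.1 - u z.2 := rfl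

theorem incr_lineMap (u v : X → ℝ) (θ : ℝ) :
    incr (AffineMap.lineMap u v θ) = AffineMap.lineMap (incr u) (incr v) θ :=
  AffineMap.apply_lineMap incr.toAffineMap u v θ

theorem incr_midpoint (u v : X → ℝ) : incr (midpoint ℝ u v) = midpoint ℝ (incr u) (incr v) :=
  incr.toAffineMap.map_midpoint u v

variable [MeasurableSpace X] {ν ρ : Measure X} {μ : Measure (X × X)} {p : ℝ} {φ : X → ℝ → ℝ}
  {M : ℝ≥0} {u v w : X → ℝ}

theorem aestronglyMeasurable_incr [SFinite ν] (hu : AEStronglyMeasurable u ν) :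
    AEStronglyMeasurable (incr u) (ν.prod ν) :=
  hu.comp_fst.sub hu.comp_snd

/-- The `p`-th power of the Gagliardo seminorm whose kernel (times `dξ dη`) is `μ`. -/
def gagliardo (μ : Measure (X × X)) (p : ℝ) (u : X → ℝ) : ℝ := ∫ z, |incr u z| ^ p ∂μ

/-- The energy whose Euler–Lagrange operator is `weakForm`. The interaction is carried by `μ`, the
lower-order term by `ρ`. -/
def energy (μ : Measure (X × X)) (ρ : Measure X) (p : ℝ) (φ : X → ℝ → ℝ) (u : X → ℝ) : ℝ :=
  p⁻¹ * gagliardo μ p u - ∫ ξ, primitive φ ξ (u ξ) ∂ρ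

/-- The first variation of `energy` at `u` in the direction `v`. -/
def weakForm (μ : Measure (X × X)) (ρ : Measure X) (p : ℝ) (φ : X → ℝ → ℝ) (u v : X → ℝ) : ℝ :=
  ∫ z, flux p (incr u z) * incr v z ∂μ - ∫ ξ, φ ξ (u ξ) * v ξ ∂ρ

theorem gagliardo_nonneg (μ : Measure (X × X)) (p : ℝ) (u : X → ℝ) : 0 ≤ gagliardo μ p u :=
  integral_nonneg fun z => by positivity

theorem weakForm_smul (u v : X → ℝ) (c : ℝ) :
    weakForm μ ρ p φ u (c • v) = c * weakForm μ ρ p φ u v := by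
  simp only [weakForm, map_smul, Pi.smul_apply, smul_eq_mul, mul_left_comm _ c, integral_const_mul,
    mul_sub]

/-- `u` has finite `L^p` norm and finite Gagliardo seminorm. -/
structure HasFiniteEnergy (ν : Measure X) (μ : Measure (X × X)) (p : ℝ) (u : X → ℝ) : Prop where
  memLp : MemLp u (ENNReal.ofReal p) ν
  memLp_incr : MemLp (incr u) (ENNReal.ofReal p) μ

theorem HasFiniteEnergy.mono_measure {ν' : Measure X} {μ' : Measure (X × X)}
    (hu : HasFiniteEnergy ν μ p u) (hν : ν' ≤ ν) (hμ : μ' ≤ μ) : HasFiniteEnergy ν' μ' p u :=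
  ⟨hu.memLp.mono_measure hν, hu.memLp_incr.mono_measure hμ⟩

theorem HasFiniteEnergy.add (hu : HasFiniteEnergy ν μ p u) (hv : HasFiniteEnergy ν μ p v) :
    HasFiniteEnergy ν μ p (u + v) :=
  ⟨hu.memLp.add hv.memLp, by rw [map_add]; exact hu.memLp_incr.add hv.memLp_incr⟩

theorem HasFiniteEnergy.const_smul (hu : HasFiniteEnergy ν μ p u) (c : ℝ) :
    HasFiniteEnergy ν μ p (c • u) :=
  ⟨hu.memLp.const_smul c, by rw [map_smul]; exact hu.memLp_incr.const_smul c⟩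

theorem HasFiniteEnergy.sub (hu : HasFiniteEnergy ν μ p u) (hv : HasFiniteEnergy ν μ p v) :
    HasFiniteEnergy ν μ p (u - v) :=
  ⟨hu.memLp.sub hv.memLp, by rw [map_sub]; exact hu.memLp_incr.sub hv.memLp_incr⟩

theorem gagliardo_sub_le (hp : 0 < p) (hu : HasFiniteEnergy ν μ p u)
    (hv : HasFiniteEnergy ν μ p v) :
    gagliardo μ p (u - v) ≤ 2 ^ p * (gagliardo μ p u + gagliardo μ p v) := by
  simpa only [gagliardo, map_sub] using integral_abs_sub_rpow_le hp hu.memLp_incr hv.memLp_incr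

variable [IsFiniteMeasure ρ]

theorem weakForm_sub_le_energy_sub (hp : 1 < p) (hρ : ρ ≤ ν) (hφ : IsBoundedForcing φ M)
    (hu : HasFiniteEnergy ν μ p u) (hv : HasFiniteEnergy ν μ p v) :
    weakForm μ ρ p φ u (v - u) ≤ energy μ ρ p φ v - energy μ ρ p φ u := by
  have hflux := integral_flux_mul_sub_le hp hu.memLp_incr hv.memLp_incr
  have hprim := hφ.integral_primitive_le (integrable_of_memLp_of_le hp.le hρ hu.memLp)
    (integrable_of_memLp_of_le hp.le hρ hv.memLp)
  simp only [weakForm, energy, gagliardo, map_sub]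
  linarith

theorem abs_weakForm_le (hp : 1 < p) (hρ : ρ ≤ ν) (hφ : IsBoundedForcing φ M)
    (hu : HasFiniteEnergy ν μ p u) (hv : HasFiniteEnergy ν μ p v) {t : ℝ} (ht : 0 < t) :
    |weakForm μ ρ p φ u v| ≤ t * (gagliardo μ p u + M * ρ.real Set.univ) +
      t ^ (1 - p) * (gagliardo μ p v + M * ∫ ξ, |v ξ| ^ p ∂ν) := by
  have hflux := abs_integral_flux_mul_le hp ht hu.memLp_incr hv.memLp_incr
  have hforcing := hφ.abs_integral_mul_le hp hρ ht (hu.memLp.1.mono_measure hρ) hv.memLp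
  refine (abs_sub _ _).trans ((add_le_add hflux hforcing).trans (le_of_eq ?_))
  simp only [gagliardo]
  ring

theorem integral_midDefect_le_energy (hp : 1 < p) (hρ : ρ ≤ ν) (hφ : IsBoundedForcing φ M)
    (hu : HasFiniteEnergy ν μ p u) (hv : HasFiniteEnergy ν μ p v) :
    p⁻¹ * ∫ z, midDefect p (incr u z) (incr v z) ∂μ ≤
      (energy μ ρ p φ u + energy μ ρ p φ v) / 2 - energy μ ρ p φ (midpoint ℝ u v) := by
  have hprim := hφ.le_integral_primitive_midpoint (integrable_of_memLp_of_le hp.le hρ hu.memLp)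
    (integrable_of_memLp_of_le hp.le hρ hv.memLp)
  rw [integral_midDefect (zero_lt_one.trans hp) hu.memLp_incr hv.memLp_incr]
  simp only [energy, gagliardo, incr_midpoint]
  linarith

theorem tendsto_weakForm_lineMap (hp : 1 < p) (hρ : ρ ≤ ν) (hφ : IsBoundedForcing φ M)
    (hu : HasFiniteEnergy ν μ p u) (hv : HasFiniteEnergy ν μ p v)
    (hw : HasFiniteEnergy ν μ p w) :
    Tendsto (fun θ : ℝ => weakForm μ ρ p φ (AffineMap.lineMap u v θ) w) (𝓝[>] 0)
      (𝓝 (weakForm μ ρ p φ u w)) := by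
  simp only [weakForm, incr_lineMap]
  exact (tendsto_integral_flux_lineMap_mul hp hu.memLp_incr hv.memLp_incr hw.memLp_incr).sub
    (hφ.tendsto_integral_lineMap_mul (hu.memLp.1.mono_measure hρ) (hv.memLp.1.mono_measure hρ)
      (integrable_of_memLp_of_le hp.le hρ hw.memLp))

end Energy

/-! ### The variational inequality on an admissible class -/

section VariationalInequality

variable {X : Type*} [MeasurableSpace X] {ν ρ : Measure X} {μ : Measure (X × X)} {p : ℝ}
  {φ : X → ℝ → ℝ} {M : ℝ≥0} {K : Set (X → ℝ)} {u v : X → ℝ}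

/-- Convex classes of functions of finite energy, closed under almost everywhere convergence, on
which the Gagliardo seminorm controls `L^p` distances. -/
structure IsAdmissibleClass (ν : Measure X) (μ : Measure (X × X)) (p : ℝ) (K : Set (X → ℝ)) :
    Prop where
  hasFiniteEnergy : ∀ u ∈ K, HasFiniteEnergy ν μ p u
  convex : Convex ℝ K
  mem_of_tendsto : ∀ (w : ℕ → X → ℝ) (u : X → ℝ), (∀ k, w k ∈ K) → HasFiniteEnergy ν μ p u →
    (∀ᵐ ξ ∂ν, Tendsto (fun k => w k ξ) atTop (𝓝 (u ξ))) → u ∈ K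
  poincare : ∃ C : ℝ, 0 ≤ C ∧ ∀ u ∈ K, ∀ v ∈ K,
    ∫ ξ, |(u - v) ξ| ^ p ∂ν ≤ C * gagliardo μ p (u - v)

theorem IsAdmissibleClass.tendsto_integral (hK : IsAdmissibleClass ν μ p K) {ι : Type*}
    {l : Filter ι} {w w' : ι → X → ℝ} (hw : ∀ i, w i ∈ K) (hw' : ∀ i, w' i ∈ K)
    (h : Tendsto (fun i => gagliardo μ p (w i - w' i)) l (𝓝 0)) :
    Tendsto (fun i => ∫ ξ, |(w i - w' i) ξ| ^ p ∂ν) l (𝓝 0) := by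
  obtain ⟨C, -, hC⟩ := hK.poincare
  exact squeeze_zero (fun i => integral_nonneg fun ξ => by positivity)
    (fun i => hC _ (hw i) _ (hw' i)) (by simpa only [mul_zero] using h.const_mul C)

theorem IsAdmissibleClass.ae_eq_of_gagliardo_eq_zero (hK : IsAdmissibleClass ν μ p K) (hp : 0 < p)
    (hu : u ∈ K) (hv : v ∈ K) (h : gagliardo μ p (u - v) = 0) : u =ᵐ[ν] v := by
  obtain ⟨C, -, hC⟩ := hK.poincare
  have hzero : ∫ ξ, |(u - v) ξ| ^ p ∂ν = 0 :=
    le_antisymm ((hC u hu v hv).trans_eq (by rw [h, mul_zero]))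
      (integral_nonneg fun ξ => by positivity)
  have hLp := ((hK.hasFiniteEnergy u hu).sub (hK.hasFiniteEnergy v hv)).memLp
  filter_upwards [(integral_eq_zero_iff_of_nonneg (fun ξ => by positivity)
    (integrable_abs_rpow hp hLp)).1 hzero] with ξ hξ
  simpa only [abs_eq_zero, Pi.sub_apply, sub_eq_zero] using
    (Real.rpow_eq_zero (abs_nonneg _) hp.ne').1 hξ

theorem exists_mul_rpow_one_sub_le (hp : 1 < p) (A : ℝ) {δ : ℝ} (hδ : 0 < δ) :
    ∃ t : ℝ, 0 < t ∧ A * t ^ (1 - p) ≤ δ := by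
  have hlim : Tendsto (fun t : ℝ => A * t ^ (1 - p)) atTop (𝓝 0) := by
    simpa only [neg_sub, mul_zero] using (tendsto_rpow_neg_atTop (sub_pos.2 hp)).const_mul A
  exact ((eventually_gt_atTop 0).and (hlim.eventually_le_const hδ)).exists

theorem IsAdmissibleClass.exists_gagliardo_le_energy [IsFiniteMeasure ρ]
    (hK : IsAdmissibleClass ν μ p K) (hp : 1 < p) (hρ : ρ ≤ ν) (hφ : IsBoundedForcing φ M) :
    ∃ B : ℝ, ∀ u ∈ K, gagliardo μ p u ≤ 2 * p * (energy μ ρ p φ u + B) := by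
  have hp0 := zero_lt_one.trans hp
  rcases K.eq_empty_or_nonempty with rfl | ⟨u₀, hu₀⟩
  · exact ⟨0, fun u hu => hu.elim⟩
  obtain ⟨C, hC0, hC⟩ := hK.poincare
  obtain ⟨t, ht, htδ⟩ := exists_mul_rpow_one_sub_le hp (M * (C * 2 ^ p)) (δ := (2 * p)⁻¹)
    (by positivity)
  refine ⟨∫ ξ, primitive φ ξ (u₀ ξ) ∂ρ + M * t * ρ.real Set.univ +
    (2 * p)⁻¹ * gagliardo μ p u₀, fun u hu => ?_⟩
  have hE := hK.hasFiniteEnergy u hu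
  have hE₀ := hK.hasFiniteEnergy u₀ hu₀
  have hprim := hφ.integral_primitive_le (integrable_of_memLp_of_le hp.le hρ hE₀.memLp)
    (integrable_of_memLp_of_le hp.le hρ hE.memLp)
  have hforcing : ∫ ξ, φ ξ (u₀ ξ) * (u - u₀) ξ ∂ρ ≤
      M * t * ρ.real Set.univ + (2 * p)⁻¹ * (gagliardo μ p u + gagliardo μ p u₀) :=
    calc ∫ ξ, φ ξ (u₀ ξ) * (u - u₀) ξ ∂ρ
        ≤ M * (t * ρ.real Set.univ + t ^ (1 - p) * ∫ ξ, |(u - u₀) ξ| ^ p ∂ν) :=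
          (le_abs_self _).trans (hφ.abs_integral_mul_le hp hρ ht (hE₀.memLp.1.mono_measure hρ)
            (hE.sub hE₀).memLp)
      _ ≤ M * (t * ρ.real Set.univ +
            t ^ (1 - p) * (C * (2 ^ p * (gagliardo μ p u + gagliardo μ p u₀)))) := by
          gcongr
          exact (hC u hu u₀ hu₀).trans (by gcongr; exact gagliardo_sub_le hp0 hE hE₀)
      _ = M * t * ρ.real Set.univ +
            M * (C * 2 ^ p) * t ^ (1 - p) * (gagliardo μ p u + gagliardo μ p u₀) := by ring
      _ ≤ _ := by
          gcongr
          exact add_nonneg (gagliardo_nonneg μ p u) (gagliardo_nonneg μ p u₀)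
  have hhalf : p⁻¹ * gagliardo μ p u = (2 * p)⁻¹ * gagliardo μ p u +
      (2 * p)⁻¹ * gagliardo μ p u := by rw [mul_inv]; ring
  rw [← inv_mul_le_iff₀ (by positivity)]
  simp only [energy]
  linarith

theorem IsAdmissibleClass.tendsto_gagliardo_sub [IsFiniteMeasure ρ]
    (hK : IsAdmissibleClass ν μ p K) (hp : 1 < p) (hρ : ρ ≤ ν) (hφ : IsBoundedForcing φ M) {m : ℝ}
    (hm : ∀ v ∈ K, m ≤ energy μ ρ p φ v) {ι : Type*} {l : Filter ι} {w w' : ι → X → ℝ}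
    (hw : ∀ i, w i ∈ K) (hw' : ∀ i, w' i ∈ K)
    (hlim : Tendsto (fun i => energy μ ρ p φ (w i)) l (𝓝 m))
    (hlim' : Tendsto (fun i => energy μ ρ p φ (w' i)) l (𝓝 m)) :
    Tendsto (fun i => gagliardo μ p (w i - w' i)) l (𝓝 0) := by
  obtain ⟨B, hB⟩ := hK.exists_gagliardo_le_energy hp hρ hφ
  have hgap : Tendsto (fun i => p * ((energy μ ρ p φ (w i) + energy μ ρ p φ (w' i)) / 2 - m)) l
      (𝓝 0) := by
    simpa using (((hlim.add hlim').div_const 2).sub_const m).const_mul p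
  refine tendsto_zero_of_forall_le_mul_add
    (R := 2 * p * (m + 1 + B) + 2 * p * (m + 1 + B)) (fun i => gagliardo_nonneg μ p _) hgap
    fun ε hε => ?_
  obtain ⟨C, hC0, hC⟩ := exists_integral_abs_sub_rpow_le_midDefect (μ := μ) hp hε
  refine ⟨C, ?_⟩
  filter_upwards [hlim.eventually_le_const (lt_add_one m),
    hlim'.eventually_le_const (lt_add_one m)] with i hi hi'
  have hE := hK.hasFiniteEnergy _ (hw i)
  have hE' := hK.hasFiniteEnergy _ (hw' i)
  have hbound : ∀ v ∈ K, energy μ ρ p φ v ≤ m + 1 → gagliardo μ p v ≤ 2 * p * (m + 1 + B) :=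
    fun v hv h => (hB v hv).trans (by gcongr)
  have hdefect : ∫ z, midDefect p (incr (w i) z) (incr (w' i) z) ∂μ ≤
      p * ((energy μ ρ p φ (w i) + energy μ ρ p φ (w' i)) / 2 - m) := by
    rw [← inv_mul_le_iff₀ (zero_lt_one.trans hp)]
    have hmid := hm _ (hK.convex.midpoint_mem (hw i) (hw' i))
    linarith [integral_midDefect_le_energy hp hρ hφ hE hE']
  calc gagliardo μ p (w i - w' i)
      ≤ ε * (gagliardo μ p (w i) + gagliardo μ p (w' i)) +
          C * ∫ z, midDefect p (incr (w i) z) (incr (w' i) z) ∂μ := by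
        simpa only [gagliardo, map_sub] using hC _ _ hE.memLp_incr hE'.memLp_incr
    _ ≤ _ := by
        gcongr
        exacts [hbound _ (hw i) hi, hbound _ (hw' i) hi']

theorem tendsto_incr_ae [SFinite ν] (hμ : μ ≪ ν.prod ν) {w : ℕ → X → ℝ}
    (h : ∀ᵐ ξ ∂ν, Tendsto (fun k => w k ξ) atTop (𝓝 (u ξ))) :
    ∀ᵐ z ∂μ, Tendsto (fun k => incr (w k) z) atTop (𝓝 (incr u z)) := by
  refine hμ.ae_le ?_
  filter_upwards [Measure.quasiMeasurePreserving_fst.ae h,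
    Measure.quasiMeasurePreserving_snd.ae h] with z hfst hsnd using hfst.sub hsnd

theorem IsAdmissibleClass.exists_tendsto_gagliardo_sub [SFinite ν]
    (hK : IsAdmissibleClass ν μ p K) (hp : 1 ≤ p) (hμ : μ ≪ ν.prod ν) {w : ℕ → X → ℝ}
    (hw : ∀ k, w k ∈ K)
    (hc : Tendsto (fun kl : ℕ × ℕ => gagliardo μ p (w kl.1 - w kl.2)) atTop (𝓝 0)) :
    ∃ u ∈ K, Tendsto (fun k => gagliardo μ p (w k - u)) atTop (𝓝 0) := by
  have hp0 : 0 < p := zero_lt_one.trans_le hp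
  have hq : 1 ≤ ENNReal.ofReal p := ENNReal.one_le_ofReal.2 hp
  have hE : ∀ k, HasFiniteEnergy ν μ p (w k) := fun k => hK.hasFiniteEnergy _ (hw k)
  have hEsub : ∀ kl : ℕ × ℕ, HasFiniteEnergy ν μ p (w kl.1 - w kl.2) := fun kl =>
    (hE kl.1).sub (hE kl.2)
  have hsub : ∀ u v : X → ℝ, incr u - incr v = incr (u - v) := fun u v => (map_sub incr u v).symm
  have hcLp : Tendsto (fun kl : ℕ × ℕ => eLpNorm (w kl.1 - w kl.2) (ENNReal.ofReal p) ν) atTop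
      (𝓝 0) :=
    (tendsto_eLpNorm_zero_iff_tendsto_integral hp0 fun kl => (hEsub kl).memLp).2
      (hK.tendsto_integral (fun kl => hw kl.1) (fun kl => hw kl.2) hc)
  have hcIncr : Tendsto (fun kl : ℕ × ℕ =>
      eLpNorm (incr (w kl.1) - incr (w kl.2)) (ENNReal.ofReal p) μ) atTop (𝓝 0) := by
    simp only [hsub]
    exact (tendsto_eLpNorm_zero_iff_tendsto_integral hp0
      fun kl => (hEsub kl).memLp_incr).2 hc
  obtain ⟨u, hu, hlim⟩ := exists_memLp_tendsto_eLpNorm_sub hq (fun k => (hE k).memLp) hcLp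
  obtain ⟨ns, hns, hae⟩ := exists_seq_tendsto_ae_of_tendsto_eLpNorm
    (zero_lt_one.trans_le hq).ne' (fun k => (hE k).memLp) hu hlim
  obtain ⟨huIncr, hlimIncr⟩ := memLp_and_tendsto_eLpNorm_of_tendsto_ae hq
    (fun k => (hE k).memLp_incr) hcIncr hns (tendsto_incr_ae hμ hae)
  have huE : HasFiniteEnergy ν μ p u := ⟨hu, huIncr⟩
  refine ⟨u, hK.mem_of_tendsto _ u (fun k => hw (ns k)) huE hae, ?_⟩
  simp only [hsub] at hlimIncr
  exact (tendsto_eLpNorm_zero_iff_tendsto_integral hp0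
    fun k => ((hE k).sub huE).memLp_incr).1 hlimIncr

theorem measureReal_mul_integral_abs_rpow_le_gagliardo [SFinite ν] {A B : Set X} {C : ℝ≥0}
    {w : X → ℝ} (hp : 0 < p) (hw : HasFiniteEnergy ν μ p w) (hAB : Disjoint A B)
    (hA : MeasurableSet A) (hw0 : ∀ᵐ ξ ∂ν.restrict Aᶜ, w ξ = 0)
    (hμ : (ν.restrict A).prod (ν.restrict B) ≤ C • μ) :
    ν.real B * ∫ ξ, |w ξ| ^ p ∂ν ≤ C * gagliardo μ p w := by
  have hwB : ∀ᵐ ξ ∂ν.restrict B, w ξ = 0 :=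
    ae_restrict_of_ae_restrict_of_subset hAB.subset_compl_left hw0
  have hincr : (fun z : X × X => |w z.1| ^ p) =ᵐ[(ν.restrict A).prod (ν.restrict B)]
      fun z => |incr w z| ^ p := by
    filter_upwards [Measure.quasiMeasurePreserving_snd.ae hwB] with z hz
    rw [incr_apply, hz, sub_zero]
  calc ν.real B * ∫ ξ, |w ξ| ^ p ∂ν
      = ν.real B * ∫ ξ in A, |w ξ| ^ p ∂ν := by
        rw [setIntegral_eq_integral_of_ae_compl_eq_zero]
        filter_upwards [(ae_restrict_iff' hA.compl).1 hw0] with ξ hξ hξA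
        rw [hξ hξA, abs_zero, Real.zero_rpow hp.ne']
    _ = ∫ z, |w z.1| ^ p ∂(ν.restrict A).prod (ν.restrict B) := by
        rw [integral_fun_fst fun ξ => |w ξ| ^ p, measureReal_restrict_apply_univ, smul_eq_mul]
    _ = ∫ z, |incr w z| ^ p ∂(ν.restrict A).prod (ν.restrict B) := integral_congr_ae hincr
    _ ≤ ∫ z, |incr w z| ^ p ∂(C • μ) :=
        integral_mono_measure hμ (.of_forall fun z => by positivity)
          ((integrable_abs_rpow hp hw.memLp_incr).smul_measure_nnreal)
    _ = C * gagliardo μ p w := integral_smul_nnreal_measure _ C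

variable [IsFiniteMeasure ρ]

theorem IsAdmissibleClass.tendsto_weakForm_sub (hK : IsAdmissibleClass ν μ p K) (hp : 1 < p)
    (hρ : ρ ≤ ν) (hφ : IsBoundedForcing φ M) {w : ℕ → X → ℝ} (hu : u ∈ K) (hw : ∀ k, w k ∈ K)
    (h : Tendsto (fun k => gagliardo μ p (w k - u)) atTop (𝓝 0)) :
    Tendsto (fun k => weakForm μ ρ p φ u (w k - u)) atTop (𝓝 0) := by
  have hdist : Tendsto (fun k => gagliardo μ p (w k - u) + M * ∫ ξ, |(w k - u) ξ| ^ p ∂ν) atTop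
      (𝓝 0) := by
    simpa using h.add ((hK.tendsto_integral hw (fun _ => hu) h).const_mul (M : ℝ))
  have hE := hK.hasFiniteEnergy u hu
  exact (tendsto_zero_iff_abs_tendsto_zero _).2 <| tendsto_zero_of_forall_le_mul_add
    (fun k => abs_nonneg _) hdist fun t ht => ⟨t ^ (1 - p), .of_forall fun k =>
      abs_weakForm_le hp hρ hφ hE ((hK.hasFiniteEnergy _ (hw k)).sub hE) ht⟩

theorem IsAdmissibleClass.energy_le_of_tendsto (hK : IsAdmissibleClass ν μ p K) (hp : 1 < p)
    (hρ : ρ ≤ ν) (hφ : IsBoundedForcing φ M) {w : ℕ → X → ℝ} {m : ℝ} (hu : u ∈ K)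
    (hw : ∀ k, w k ∈ K) (h : Tendsto (fun k => gagliardo μ p (w k - u)) atTop (𝓝 0))
    (hm : Tendsto (fun k => energy μ ρ p φ (w k)) atTop (𝓝 m)) : energy μ ρ p φ u ≤ m := by
  have htangent : Tendsto (fun k => energy μ ρ p φ u + weakForm μ ρ p φ u (w k - u)) atTop
      (𝓝 (energy μ ρ p φ u)) := by
    simpa using (hK.tendsto_weakForm_sub hp hρ hφ hu hw h).const_add (energy μ ρ p φ u)
  refine le_of_tendsto_of_tendsto' htangent hm fun k => ?_
  linarith [weakForm_sub_le_energy_sub hp hρ hφ (hK.hasFiniteEnergy u hu)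
    (hK.hasFiniteEnergy _ (hw k))]

theorem IsAdmissibleClass.exists_isMinOn_energy [SFinite ν] (hK : IsAdmissibleClass ν μ p K)
    (hp : 1 < p) (hμ : μ ≪ ν.prod ν) (hρ : ρ ≤ ν) (hφ : IsBoundedForcing φ M)
    (hne : K.Nonempty) : ∃ u ∈ K, IsMinOn (energy μ ρ p φ) K u := by
  obtain ⟨B, hB⟩ := hK.exists_gagliardo_le_energy hp hρ hφ
  have hbdd : BddBelow (energy μ ρ p φ '' K) := by
    refine ⟨-B, Set.forall_mem_image.2 fun u hu => ?_⟩
    have hnonneg : 0 ≤ energy μ ρ p φ u + B := nonneg_of_mul_nonneg_right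
      ((gagliardo_nonneg μ p u).trans (hB u hu)) (by positivity)
    linarith
  have hm : ∀ v ∈ K, sInf (energy μ ρ p φ '' K) ≤ energy μ ρ p φ v :=
    fun v hv => csInf_le hbdd (Set.mem_image_of_mem _ hv)
  obtain ⟨a, -, ha, haK⟩ := exists_seq_tendsto_sInf (hne.image _) hbdd
  choose w hw hwa using haK
  obtain rfl : a = fun k => energy μ ρ p φ (w k) := funext fun k => (hwa k).symm
  obtain ⟨u, hu, hlim⟩ := hK.exists_tendsto_gagliardo_sub hp.le hμ hw <|
    hK.tendsto_gagliardo_sub hp hρ hφ hm (fun kl => hw kl.1) (fun kl => hw kl.2)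
      (ha.comp (tendsto_fst.mono_left prod_atTop_atTop_eq.ge))
      (ha.comp (tendsto_snd.mono_left prod_atTop_atTop_eq.ge))
  exact ⟨u, hu, fun v hv => (hK.energy_le_of_tendsto hp hρ hφ hu hw hlim ha).trans (hm v hv)⟩

theorem IsAdmissibleClass.ae_eq_of_isMinOn_energy (hK : IsAdmissibleClass ν μ p K) (hp : 1 < p)
    (hρ : ρ ≤ ν) (hφ : IsBoundedForcing φ M) (hu : u ∈ K) (hv : v ∈ K)
    (hu_min : IsMinOn (energy μ ρ p φ) K u) (hv_min : IsMinOn (energy μ ρ p φ) K v) :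
    u =ᵐ[ν] v := by
  have heq : energy μ ρ p φ v = energy μ ρ p φ u := le_antisymm (hv_min hu) (hu_min hv)
  have hlim := hK.tendsto_gagliardo_sub (l := (atTop : Filter ℕ)) hp hρ hφ (fun w hw => hu_min hw)
    (fun _ => hu) (fun _ => hv) tendsto_const_nhds (heq ▸ tendsto_const_nhds)
  exact hK.ae_eq_of_gagliardo_eq_zero (zero_lt_one.trans hp) hu hv
    (tendsto_nhds_unique tendsto_const_nhds hlim)

theorem IsAdmissibleClass.isMinOn_energy_iff (hK : IsAdmissibleClass ν μ p K) (hp : 1 < p)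
    (hρ : ρ ≤ ν) (hφ : IsBoundedForcing φ M) (hu : u ∈ K) :
    IsMinOn (energy μ ρ p φ) K u ↔ ∀ v ∈ K, 0 ≤ weakForm μ ρ p φ u (v - u) := by
  have hE := hK.hasFiniteEnergy
  refine ⟨fun hmin v hv => ?_, fun h v hv => sub_nonneg.1 <| (h v hv).trans <|
    weakForm_sub_le_energy_sub hp hρ hφ (hE u hu) (hE v hv)⟩
  -- Minty's trick: test at points of the segment from `u` to `v` and let them tend to `u`.
  refine ge_of_tendsto (tendsto_weakForm_lineMap hp hρ hφ (hE u hu) (hE v hv)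
    ((hE v hv).sub (hE u hu))) ?_
  filter_upwards [Ioc_mem_nhdsGT one_pos] with θ hθ
  have hmem : AffineMap.lineMap u v θ ∈ K := hK.convex.lineMap_mem hu hv ⟨hθ.1.le, hθ.2⟩
  have hback : u - AffineMap.lineMap u v θ = -θ • (v - u) := by
    rw [AffineMap.lineMap_apply_module']
    simp
  have htest : -θ * weakForm μ ρ p φ (AffineMap.lineMap u v θ) (v - u) ≤ 0 := by
    rw [← weakForm_smul, ← hback]
    exact (weakForm_sub_le_energy_sub hp hρ hφ (hE _ hmem) (hE u hu)).trans
      (sub_nonpos.2 (hmin hmem))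
  exact nonneg_of_mul_nonneg_right (by linarith) hθ.1

theorem IsAdmissibleClass.exists_weakForm_nonneg_and_ae_eq [SFinite ν]
    (hK : IsAdmissibleClass ν μ p K) (hp : 1 < p) (hμ : μ ≪ ν.prod ν) (hρ : ρ ≤ ν)
    (hφ : IsBoundedForcing φ M) (hne : K.Nonempty) :
    ∃ u ∈ K, (∀ v ∈ K, 0 ≤ weakForm μ ρ p φ u (v - u)) ∧
      ∀ w ∈ K, (∀ v ∈ K, 0 ≤ weakForm μ ρ p φ w (v - w)) → w =ᵐ[ν] u := by
  obtain ⟨u, hu, hmin⟩ := hK.exists_isMinOn_energy hp hμ hρ hφ hne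
  refine ⟨u, hu, (hK.isMinOn_energy_iff hp hρ hφ hu).1 hmin, fun w hw h => ?_⟩
  exact hK.ae_eq_of_isMinOn_energy hp hρ hφ hw hu ((hK.isMinOn_energy_iff hp hρ hφ hw).2 h) hmin

end VariationalInequality

end NonlocalObstacle

namespace Heis

open NonlocalObstacle

/-! ### Geometry of the Heisenberg group -/

section Geometry

variable {n : ℕ} {d d₁ d₂ : Heis n → ℝ}

protected theorem mul_zero (ξ : Heis n) : mul ξ 0 = ξ := by
  simp [mul]

protected theorem zero_mul (ξ : Heis n) : mul 0 ξ = ξ := by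
  simp [mul]

theorem inv_zero : inv (0 : Heis n) = 0 := by
  simp [inv]

theorem mul_inv_self (ξ : Heis n) : mul ξ (inv ξ) = 0 := by
  refine Prod.ext ?_ (Prod.ext ?_ ?_) <;> simp [mul, inv, mul_comm]

protected theorem mul_inv_cancel_left (ξ η : Heis n) : mul ξ (mul (inv ξ) η) = η := by
  rw [← mul_assoc, mul_inv_self, Heis.zero_mul]

protected theorem inv_mul_eq_zero (ξ η : Heis n) : mul (inv η) ξ = 0 ↔ ξ = η := by
  refine ⟨fun h => ?_, fun h => h ▸ inv_mul_self η⟩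
  rw [← Heis.mul_inv_cancel_left η ξ, h, Heis.mul_zero]

theorem inv_inv_mul (ξ η : Heis n) : inv (mul (inv η) ξ) = mul (inv ξ) η := by
  refine Prod.ext ?_ (Prod.ext ?_ ?_)
  · simp [mul, inv, add_comm]
  · simp [mul, inv, add_comm]
  · simp only [mul, inv, Pi.neg_apply, neg_mul, Finset.sum_neg_distrib, mul_comm (ξ.1 _),
      mul_comm (ξ.2.1 _)]
    ring

theorem continuous_inv_mul : Continuous fun z : Heis n × Heis n => mul (inv z.2) z.1 := by
  unfold mul inv
  fun_prop

theorem continuous_mul_inv : Continuous fun z : Heis n × Heis n => mul z.1 (inv z.2) := by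
  unfold mul inv
  fun_prop

theorem measurePreserving_inv_mul (ξ : Heis n) :
    MeasurePreserving (fun η : Heis n => mul (inv η) ξ) := by
  let fiberMap : (Fin n → ℝ) → (Fin n → ℝ) × ℝ → (Fin n → ℝ) × ℝ := fun x w =>
    (ξ.2.1 - w.1, (ξ.2.2 + 2 * (∑ i, (-w.1) i * ξ.1 i) - 2 * ∑ i, (-x) i * ξ.2.1 i) - w.2)
  have hfiber : ∀ x, MeasurePreserving (fiberMap x) := fun x =>
    MeasurePreserving.skew_product (f := fun y => ξ.2.1 - y)
      (g := fun y t => (ξ.2.2 + 2 * (∑ i, (-y) i * ξ.1 i) - 2 * ∑ i, (-x) i * ξ.2.1 i) - t)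
      (Measure.measurePreserving_sub_left volume _)
      (Continuous.measurable (by unfold Function.uncurry; fun_prop))
      (.of_forall fun y => (Measure.measurePreserving_sub_left volume _).map_eq)
  have hskew := MeasurePreserving.skew_product (f := fun x : Fin n → ℝ => ξ.1 - x) (g := fiberMap)
    (Measure.measurePreserving_sub_left volume _)
    (Continuous.measurable (by unfold Function.uncurry; fun_prop))
    (.of_forall fun x => (hfiber x).map_eq)
  have heq : (fun η : Heis n => mul (inv η) ξ) = fun w => (ξ.1 - w.1, fiberMap w.1 w.2) := by
    ext1 η
    refine Prod.ext ?_ (Prod.ext ?_ ?_)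
    · simp only [mul, inv]; abel
    · simp only [mul, inv, fiberMap]; abel
    · simp only [mul, inv, fiberMap]; ring
  exact heq ▸ hskew

theorem measurePreserving_prodMk_inv_mul :
    MeasurePreserving fun z : Heis n × Heis n => (z.1, mul (inv z.2) z.1) :=
  MeasurePreserving.skew_product (f := id) (g := fun ξ η => mul (inv η) ξ)
    (MeasurePreserving.id _) continuous_inv_mul.measurable
    (.of_forall fun ξ => (measurePreserving_inv_mul ξ).map_eq)

theorem homDim_pos (n : ℕ) : 0 < homDim n := by
  unfold homDim
  positivity

theorem stdNorm_nonneg (ξ : Heis n) : 0 ≤ stdNorm ξ := by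
  unfold stdNorm
  positivity

theorem stdNorm_pow_four (ξ : Heis n) :
    stdNorm ξ ^ 4 = ((∑ i, ξ.1 i ^ 2) + ∑ i, ξ.2.1 i ^ 2) ^ 2 + ξ.2.2 ^ 2 := by
  unfold stdNorm
  rw [← Real.rpow_natCast, ← Real.rpow_mul (by positivity)]
  norm_num

theorem stdNorm_inv (ξ : Heis n) : stdNorm (inv ξ) = stdNorm ξ := by
  simp [stdNorm, inv]

theorem stdNorm_inv_mul_comm (ξ η : Heis n) :
    stdNorm (mul (inv η) ξ) = stdNorm (mul (inv ξ) η) := by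
  rw [← inv_inv_mul, stdNorm_inv]

theorem abs_snd_snd_le_stdNorm_sq (ξ : Heis n) : |ξ.2.2| ≤ stdNorm ξ ^ 2 := by
  refine abs_le_of_sq_le_sq ?_ (by positivity)
  rw [← pow_mul, stdNorm_pow_four]
  exact le_add_of_nonneg_left (by positivity)

theorem sum_sq_le_stdNorm_sq (ξ : Heis n) :
    (∑ i, ξ.1 i ^ 2) + ∑ i, ξ.2.1 i ^ 2 ≤ stdNorm ξ ^ 2 := by
  refine le_of_sq_le_sq ?_ (by positivity)
  rw [← pow_mul, stdNorm_pow_four]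
  exact le_add_of_nonneg_right (by positivity)

theorem norm_fst_le_stdNorm (ξ : Heis n) : ‖ξ.1‖ ≤ stdNorm ξ := by
  refine (pi_norm_le_iff_of_nonneg (stdNorm_nonneg ξ)).2 fun i =>
    abs_le_of_sq_le_sq ?_ (stdNorm_nonneg ξ)
  calc ξ.1 i ^ 2 ≤ ∑ i, ξ.1 i ^ 2 :=
        Finset.single_le_sum (fun j _ => sq_nonneg (ξ.1 j)) (Finset.mem_univ i)
    _ ≤ (∑ i, ξ.1 i ^ 2) + ∑ i, ξ.2.1 i ^ 2 := le_add_of_nonneg_right (by positivity)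
    _ ≤ stdNorm ξ ^ 2 := sum_sq_le_stdNorm_sq ξ

theorem norm_snd_fst_le_stdNorm (ξ : Heis n) : ‖ξ.2.1‖ ≤ stdNorm ξ := by
  refine (pi_norm_le_iff_of_nonneg (stdNorm_nonneg ξ)).2 fun i =>
    abs_le_of_sq_le_sq ?_ (stdNorm_nonneg ξ)
  calc ξ.2.1 i ^ 2 ≤ ∑ i, ξ.2.1 i ^ 2 :=
        Finset.single_le_sum (fun j _ => sq_nonneg (ξ.2.1 j)) (Finset.mem_univ i)
    _ ≤ (∑ i, ξ.1 i ^ 2) + ∑ i, ξ.2.1 i ^ 2 := le_add_of_nonneg_left (by positivity)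
    _ ≤ stdNorm ξ ^ 2 := sum_sq_le_stdNorm_sq ξ

theorem norm_le_stdNorm {ξ : Heis n} (h : stdNorm ξ ≤ 1) : ‖ξ‖ ≤ stdNorm ξ :=
  norm_prod_le_iff.2 ⟨norm_fst_le_stdNorm ξ, norm_prod_le_iff.2 ⟨norm_snd_fst_le_stdNorm ξ,
    (abs_snd_snd_le_stdNorm_sq ξ).trans (pow_le_of_le_one (stdNorm_nonneg ξ) h two_ne_zero)⟩⟩

theorem isHomogeneousNorm_stdNorm : IsHomogeneousNorm (stdNorm : Heis n → ℝ) where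
  continuous := by
    unfold stdNorm
    exact Continuous.rpow_const (by fun_prop) fun _ => Or.inr (by norm_num)
  nonneg := stdNorm_nonneg
  map_dil r hr ξ := by
    refine (pow_left_inj₀ (stdNorm_nonneg _) (mul_nonneg hr.le (stdNorm_nonneg _))
      four_ne_zero).1 ?_
    rw [mul_pow, stdNorm_pow_four, stdNorm_pow_four]
    simp only [dil, Pi.smul_apply, smul_eq_mul, mul_pow, ← Finset.mul_sum]
    ring
  eq_zero_iff ξ := by
    refine ⟨fun h => norm_le_zero_iff.1 ((norm_le_stdNorm (h.trans_le zero_le_one)).trans_eq h), ?_⟩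
    rintro rfl
    simp [stdNorm]

theorem IsHomogeneousNorm.pos (hd : IsHomogeneousNorm d) {ξ : Heis n} (hξ : ξ ≠ 0) : 0 < d ξ :=
  (hd.nonneg ξ).lt_of_ne' (mt (hd.eq_zero_iff ξ).1 hξ)

theorem isCompact_setOf_stdNorm_eq_one : IsCompact {ξ : Heis n | stdNorm ξ = 1} := by
  refine Metric.isCompact_of_isClosed_isBounded
    (isClosed_eq isHomogeneousNorm_stdNorm.continuous continuous_const)
    ((Metric.isBounded_closedBall (x := 0) (r := 1)).subset fun ξ (hξ : stdNorm ξ = 1) => ?_)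
  exact mem_closedBall_zero_iff.2 ((norm_le_stdNorm hξ.le).trans_eq hξ)

theorem IsHomogeneousNorm.exists_le_mul (h₁ : IsHomogeneousNorm d₁) (h₂ : IsHomogeneousNorm d₂) :
    ∃ C : ℝ, 0 < C ∧ ∀ ξ, d₁ ξ ≤ C * d₂ ξ := by
  have hN := isHomogeneousNorm_stdNorm (n := n)
  have hpos : ∀ ξ : Heis n, stdNorm ξ = 1 → 0 < d₂ ξ := fun ξ hξ =>
    h₂.pos fun h => one_ne_zero (hξ.symm.trans ((hN.eq_zero_iff ξ).2 h))
  obtain ⟨C, hC⟩ := isCompact_setOf_stdNorm_eq_one.exists_bound_of_continuousOn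
    (h₁.continuous.continuousOn.div h₂.continuous.continuousOn fun ξ hξ => (hpos ξ hξ).ne')
  have hsphere : ∀ ξ : Heis n, stdNorm ξ = 1 → d₁ ξ ≤ max C 1 * d₂ ξ := fun ξ hξ =>
    (div_le_iff₀ (hpos ξ hξ)).1 ((le_abs_self _).trans ((hC ξ hξ).trans (le_max_left C 1)))
  refine ⟨max C 1, by positivity, fun ξ => ?_⟩
  rcases eq_or_ne ξ 0 with rfl | hξ
  · rw [(h₁.eq_zero_iff 0).2 rfl, (h₂.eq_zero_iff 0).2 rfl, mul_zero]
  · have hr : 0 < (stdNorm ξ)⁻¹ := inv_pos.2 (hN.pos hξ)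
    have hdil := hsphere (dil (stdNorm ξ)⁻¹ ξ)
      (by rw [hN.map_dil _ hr, inv_mul_cancel₀ (hN.pos hξ).ne'])
    rw [h₁.map_dil _ hr, h₂.map_dil _ hr, mul_left_comm] at hdil
    exact le_of_mul_le_mul_left hdil hr

theorem one_add_norm_rpow_mul_le {q a b c : ℝ} (ha : 0 ≤ a) (hb : 0 ≤ b) (hc : 0 ≤ c)
    (hq : a + b + 2 * c = q) (ξ : Heis n) :
    (1 + ‖ξ.1‖) ^ a * ((1 + ‖ξ.2.1‖) ^ b * (1 + ‖ξ.2.2‖) ^ c) ≤ (1 + stdNorm ξ) ^ q := by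
  have hN : 0 < 1 + stdNorm ξ := add_pos_of_pos_of_nonneg one_pos (stdNorm_nonneg ξ)
  have hthird : 1 + ‖ξ.2.2‖ ≤ (1 + stdNorm ξ) ^ (2 : ℝ) := by
    rw [Real.rpow_two, Real.norm_eq_abs]
    linarith [abs_snd_snd_le_stdNorm_sq ξ, stdNorm_nonneg ξ, add_sq 1 (stdNorm ξ)]
  calc (1 + ‖ξ.1‖) ^ a * ((1 + ‖ξ.2.1‖) ^ b * (1 + ‖ξ.2.2‖) ^ c)
      ≤ (1 + stdNorm ξ) ^ a * ((1 + stdNorm ξ) ^ b * ((1 + stdNorm ξ) ^ (2 : ℝ)) ^ c) := by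
        gcongr
        · exact norm_fst_le_stdNorm ξ
        · exact norm_snd_fst_le_stdNorm ξ
    _ = (1 + stdNorm ξ) ^ q := by
        rw [← Real.rpow_mul hN.le, ← Real.rpow_add hN, ← Real.rpow_add hN, ← hq, add_assoc]

theorem integrable_one_add_stdNorm_rpow {q : ℝ} (hq : homDim n < q) :
    Integrable fun ξ : Heis n => (1 + stdNorm ξ) ^ (-q) := by
  -- The excess `q - Q` is shared out between the three factors of `ℝⁿ × ℝⁿ × ℝ`.
  obtain ⟨e, he⟩ : ∃ e, e = (q - homDim n) / 4 := ⟨_, rfl⟩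
  have he0 : 0 < e := by linarith
  have hfactor : Integrable fun x : Fin n → ℝ => (1 + ‖x‖) ^ (-((n : ℝ) + e)) :=
    integrable_one_add_norm (by simpa using he0)
  have hcenter : Integrable fun t : ℝ => (1 + ‖t‖) ^ (-(1 + e)) :=
    integrable_one_add_norm (by simpa using he0)
  have hmeas : Measurable fun ξ : Heis n => (1 + stdNorm ξ) ^ (-q) :=
    (isHomogeneousNorm_stdNorm.continuous.measurable.const_add 1).pow_const _
  refine (hfactor.mul_prod (hfactor.mul_prod hcenter)).mono' hmeas.aestronglyMeasurable
    (.of_forall fun ξ => ?_)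
  have hN : 0 < 1 + stdNorm ξ := add_pos_of_pos_of_nonneg one_pos (stdNorm_nonneg ξ)
  rw [Real.norm_of_nonneg (Real.rpow_nonneg hN.le _)]
  simp only [Real.rpow_neg hN.le, Real.rpow_neg (add_nonneg zero_le_one (norm_nonneg _)), ← mul_inv]
  refine inv_anti₀ (by positivity) (one_add_norm_rpow_mul_le (by positivity) (by positivity)
    (by positivity) ?_ ξ)
  rw [he, homDim]
  ring

theorem integrableOn_stdNorm_rpow {q δ : ℝ} (hq : homDim n < q) (hδ : 0 < δ) :
    IntegrableOn (fun ξ : Heis n => (stdNorm ξ ^ q)⁻¹) {ξ | δ ≤ stdNorm ξ} := by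
  have hcont := (isHomogeneousNorm_stdNorm (n := n)).continuous
  have hq0 : 0 < q := (homDim_pos n).trans hq
  refine ((integrable_one_add_stdNorm_rpow hq).integrableOn.const_mul ((δ⁻¹ + 1) ^ q)).mono'
    (hcont.measurable.pow_const _).inv.aestronglyMeasurable ?_
  filter_upwards [ae_restrict_mem (isClosed_le continuous_const hcont).measurableSet] with ξ hξ
  have hN : 0 < stdNorm ξ := hδ.trans_le hξ
  have hle : 1 + stdNorm ξ ≤ (δ⁻¹ + 1) * stdNorm ξ := by
    have : 1 ≤ δ⁻¹ * stdNorm ξ := by rwa [inv_mul_eq_div, one_le_div hδ]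
    linarith
  rw [Real.norm_of_nonneg (by positivity), Real.rpow_neg (by positivity), ← div_eq_mul_inv,
    le_div_iff₀ (by positivity), inv_mul_le_iff₀ (by positivity), mul_comm,
    ← Real.mul_rpow (by positivity) hN.le]
  exact Real.rpow_le_rpow (by positivity) hle hq0.le

theorem exists_le_stdNorm_of_notMem {Ω Ω' : Set (Heis n)} (hΩ : Bornology.IsBounded Ω)
    (hΩ' : IsOpen Ω') (hsub : closure Ω ⊆ Ω') :
    ∃ δ : ℝ, 0 < δ ∧ ∀ ξ ∈ Ω, ∀ η ∉ Ω', δ ≤ stdNorm (mul (inv η) ξ) := by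
  obtain ⟨U, V, -, hV, hU, h0, hUV⟩ := generalized_tube_lemma hΩ.isCompact_closure
    (isCompact_singleton (x := 0)) (hΩ'.preimage continuous_mul_inv) (by
      rintro ⟨ξ, ζ⟩ ⟨hξ, rfl⟩
      simpa only [Set.mem_preimage, inv_zero, Heis.mul_zero] using hsub hξ)
  obtain ⟨r, hr, hball⟩ := Metric.isOpen_iff.1 hV 0 (h0 rfl)
  refine ⟨min r 1, by positivity, fun ξ hξ η hη => not_lt.1 fun hlt => hη ?_⟩
  have hmem : mul (inv η) ξ ∈ V := hball <| mem_ball_zero_iff.2 <|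
    (norm_le_stdNorm (hlt.le.trans (min_le_right _ _))).trans_lt (hlt.trans_le (min_le_left _ _))
  have htranslate : mul ξ (inv (mul (inv η) ξ)) ∈ Ω' :=
    hUV (Set.mk_mem_prod (hU (subset_closure hξ)) hmem)
  rwa [inv_inv_mul, Heis.mul_inv_cancel_left] at htranslate

end Geometry

/-! ### The interaction measure of the fractional `p`-Laplacian -/

section KernelMeasure

variable {n : ℕ} {s p : ℝ} {d d₁ d₂ u : Heis n → ℝ}

/-- The singular kernel `d(η⁻¹ ∘ ξ)^{-(Q + sp)}` at `z = (ξ, η)`; on the diagonal its value is the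
junk value `0⁻¹ = 0` as soon as `Q + sp ≠ 0`. -/
def kernel (d : Heis n → ℝ) (s p : ℝ) (z : Heis n × Heis n) : ℝ :=
  (d (mul (inv z.2) z.1) ^ (homDim n + s * p))⁻¹

/-- The measure `d(η⁻¹ ∘ ξ)^{-(Q + sp)} dξ dη`, against which the nonlocal term of the operator is
an integral of increments. -/
def kernelMeasure (d : Heis n → ℝ) (s p : ℝ) : Measure (Heis n × Heis n) :=
  volume.withDensity fun z => ENNReal.ofReal (kernel d s p z)

theorem homDim_lt_add_mul (hs : 0 < s) (hp : 0 < p) : homDim n < homDim n + s * p :=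
  lt_add_of_pos_right _ (mul_pos hs hp)

theorem homDim_add_mul_pos (hs : 0 < s) (hp : 0 < p) : 0 < homDim n + s * p :=
  (homDim_pos n).trans (homDim_lt_add_mul hs hp)

theorem IsHomogeneousNorm.kernel_nonneg (hd : IsHomogeneousNorm d) (s p : ℝ)
    (z : Heis n × Heis n) : 0 ≤ kernel d s p z :=
  inv_nonneg.2 (Real.rpow_nonneg (hd.nonneg _) _)

theorem IsHomogeneousNorm.measurable_kernel (hd : IsHomogeneousNorm d) (s p : ℝ) :
    Measurable (kernel d s p) :=
  ((hd.continuous.comp continuous_inv_mul).measurable.pow_const _).inv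

theorem kernel_stdNorm_swap (s p : ℝ) (z : Heis n × Heis n) :
    kernel stdNorm s p z.swap = kernel stdNorm s p z := by
  simp only [kernel, Prod.fst_swap, Prod.snd_swap, stdNorm_inv_mul_comm z.1]

theorem kernelMeasure_absolutelyContinuous (d : Heis n → ℝ) (s p : ℝ) :
    kernelMeasure d s p ≪ volume :=
  withDensity_absolutelyContinuous _ _

theorem smul_kernelMeasure (d : Heis n → ℝ) (s p : ℝ) (C : ℝ≥0) :
    C • kernelMeasure d s p = volume.withDensity fun z => ENNReal.ofReal (C * kernel d s p z) := by
  simp only [ENNReal.ofReal_mul C.coe_nonneg, ENNReal.ofReal_coe_nnreal]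
  exact (withDensity_smul' (C : ℝ≥0∞) _ ENNReal.coe_ne_top).symm

theorem IsHomogeneousNorm.integrableOn_kernelMeasure_iff (hd : IsHomogeneousNorm d)
    {F : Heis n × Heis n → ℝ} {S : Set (Heis n × Heis n)} :
    IntegrableOn F S (kernelMeasure d s p) ↔ IntegrableOn (fun z => F z * kernel d s p z) S := by
  rw [IntegrableOn, kernelMeasure, restrict_withDensity', integrable_withDensity_iff
    (hd.measurable_kernel s p).ennreal_ofReal (.of_forall fun z => ENNReal.ofReal_lt_top)]
  simp only [ENNReal.toReal_ofReal (hd.kernel_nonneg s p _)]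
  rfl

theorem IsHomogeneousNorm.integrable_kernelMeasure_iff (hd : IsHomogeneousNorm d)
    {F : Heis n × Heis n → ℝ} :
    Integrable F (kernelMeasure d s p) ↔ Integrable fun z => F z * kernel d s p z := by
  simpa only [integrableOn_univ] using hd.integrableOn_kernelMeasure_iff (S := Set.univ)

theorem IsHomogeneousNorm.integral_kernelMeasure (hd : IsHomogeneousNorm d)
    (F : Heis n × Heis n → ℝ) :
    ∫ z, F z ∂(kernelMeasure d s p) = ∫ z, F z * kernel d s p z := by
  rw [kernelMeasure, integral_withDensity_eq_integral_toReal_smul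
    (hd.measurable_kernel s p).ennreal_ofReal (.of_forall fun z => ENNReal.ofReal_lt_top)]
  simp only [ENNReal.toReal_ofReal (hd.kernel_nonneg s p _), smul_eq_mul, mul_comm]

theorem kernel_le_mul_kernel (h₁ : IsHomogeneousNorm d₁) (h₂ : IsHomogeneousNorm d₂)
    (hq : 0 < homDim n + s * p) {C : ℝ} (hC : 0 ≤ C) (h : ∀ ξ, d₂ ξ ≤ C * d₁ ξ)
    (z : Heis n × Heis n) : kernel d₁ s p z ≤ C ^ (homDim n + s * p) * kernel d₂ s p z := by
  unfold kernel
  rcases eq_or_ne (mul (inv z.2) z.1) 0 with hz | hz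
  · rw [hz, (h₁.eq_zero_iff 0).2 rfl, (h₂.eq_zero_iff 0).2 rfl, Real.zero_rpow hq.ne',
      _root_.inv_zero, mul_zero]
  · have hd₁ := h₁.pos hz
    have hd₂ := h₂.pos hz
    rw [← div_eq_mul_inv, le_div_iff₀ (by positivity), inv_mul_le_iff₀ (by positivity),
      ← Real.mul_rpow hd₁.le hC]
    exact Real.rpow_le_rpow hd₂.le ((h _).trans_eq (mul_comm _ _)) hq.le

theorem exists_kernelMeasure_le_smul (h₁ : IsHomogeneousNorm d₁) (h₂ : IsHomogeneousNorm d₂)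
    (hq : 0 < homDim n + s * p) :
    ∃ C : ℝ≥0, kernelMeasure d₁ s p ≤ C • kernelMeasure d₂ s p := by
  obtain ⟨C, hC, hle⟩ := h₂.exists_le_mul h₁
  refine ⟨(C ^ (homDim n + s * p)).toNNReal, ?_⟩
  rw [smul_kernelMeasure, Real.coe_toNNReal _ (by positivity)]
  exact withDensity_mono (.of_forall fun z =>
    ENNReal.ofReal_le_ofReal (kernel_le_mul_kernel h₁ h₂ hq hC.le hle z))

theorem exists_prod_restrict_le_smul_kernelMeasure (hd : IsHomogeneousNorm d)
    (hq : 0 ≤ homDim n + s * p) {A B : Set (Heis n)} (hA : MeasurableSet A)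
    (hB : MeasurableSet B) (hAb : Bornology.IsBounded A) (hBb : Bornology.IsBounded B)
    (hAB : Disjoint A B) :
    ∃ C : ℝ≥0, ((volume : Measure (Heis n)).restrict A).prod (volume.restrict B) ≤
      C • kernelMeasure d s p := by
  obtain ⟨D, hD⟩ := (hAb.isCompact_closure.prod hBb.isCompact_closure).exists_bound_of_continuousOn
    (hd.continuous.comp continuous_inv_mul).continuousOn
  refine ⟨(max D 1 ^ (homDim n + s * p)).toNNReal, ?_⟩
  rw [Measure.prod_restrict, ← Measure.volume_eq_prod, ← withDensity_indicator_one (hA.prod hB),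
    smul_kernelMeasure, Real.coe_toNNReal _ (by positivity)]
  refine withDensity_mono (.of_forall (Set.indicator_le' (fun z hz => ?_) fun z _ => zero_le))
  have hpos : 0 < d (mul (inv z.2) z.1) := hd.pos fun h =>
    hAB.ne_of_mem hz.1 hz.2 ((Heis.inv_mul_eq_zero _ _).1 h)
  have hle : d (mul (inv z.2) z.1) ≤ max D 1 := (le_abs_self _).trans
    ((hD z ⟨subset_closure hz.1, subset_closure hz.2⟩).trans (le_max_left D 1))
  rw [Pi.one_apply, ENNReal.one_le_ofReal, kernel, ← div_eq_mul_inv,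
    one_le_div (by positivity)]
  exact Real.rpow_le_rpow hpos.le hle hq

theorem hasFiniteEnergy_kernelMeasure_iff (h₁ : IsHomogeneousNorm d₁) (h₂ : IsHomogeneousNorm d₂)
    (hq : 0 < homDim n + s * p) :
    HasFiniteEnergy volume (kernelMeasure d₁ s p) p u ↔
      HasFiniteEnergy volume (kernelMeasure d₂ s p) p u := by
  obtain ⟨C₁, hC₁⟩ := exists_kernelMeasure_le_smul h₁ h₂ hq
  obtain ⟨C₂, hC₂⟩ := exists_kernelMeasure_le_smul h₂ h₁ hq
  exact ⟨fun h => ⟨h.memLp, h.memLp_incr.of_measure_le_smul ENNReal.coe_ne_top hC₂⟩,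
    fun h => ⟨h.memLp, h.memLp_incr.of_measure_le_smul ENNReal.coe_ne_top hC₁⟩⟩

end KernelMeasure

/-! ### Fractional Sobolev functions as functions of finite energy -/

section Sobolev

variable {n : ℕ} {s p δ : ℝ} {u : Heis n → ℝ} {Ω Ω' U : Set (Heis n)}

theorem memWsp_iff_hasFiniteEnergy (hp : 0 < p) :
    MemWsp s p U u ↔
      HasFiniteEnergy (volume.restrict U) ((kernelMeasure stdNorm s p).restrict (U ×ˢ U)) p u := by
  have hN := isHomogeneousNorm_stdNorm (n := n)
  rw [MemWsp]
  refine (and_congr_right fun hu => ?_).trans ⟨fun h => ⟨h.1, h.2⟩, fun h => ⟨h.1, h.2⟩⟩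
  have hincr := aestronglyMeasurable_incr hu.1
  have hquot : AEStronglyMeasurable (fun z : Heis n × Heis n =>
      |u z.1 - u z.2| / stdNorm (mul (inv z.2) z.1) ^ (homDim n / p + s))
      ((volume.restrict U).prod (volume.restrict U)) :=
    (hincr.aemeasurable.abs.div ((hN.continuous.comp
      continuous_inv_mul).measurable.pow_const _).aemeasurable).aestronglyMeasurable
  have hac : (kernelMeasure stdNorm s p).restrict (U ×ˢ U) ≪
      (volume.restrict U).prod (volume.restrict U) := by
    rw [Measure.prod_restrict]
    exact (kernelMeasure_absolutelyContinuous _ s p).restrict _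
  rw [memLp_ofReal_iff hp hquot, memLp_ofReal_iff hp (hincr.mono_ac hac), Measure.prod_restrict]
  refine Iff.trans (integrable_congr (.of_forall fun z => ?_))
    hN.integrableOn_kernelMeasure_iff.symm
  have h0 := stdNorm_nonneg (mul (inv z.2) z.1)
  have hexp : (homDim n / p + s) * p = homDim n + s * p := by field_simp
  simp only [kernel, incr_apply]
  rw [abs_div, abs_abs, abs_of_nonneg (Real.rpow_nonneg h0 _),
    Real.div_rpow (abs_nonneg _) (Real.rpow_nonneg h0 _), ← Real.rpow_mul h0, hexp, div_eq_mul_inv]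

theorem memWsp_univ_iff (hp : 0 < p) :
    MemWsp s p Set.univ u ↔ HasFiniteEnergy volume (kernelMeasure stdNorm s p) p u := by
  rw [memWsp_iff_hasFiniteEnergy hp, Set.univ_prod_univ, Measure.restrict_univ,
    Measure.restrict_univ]

/-- The pairs `(ξ, η)` with `|η⁻¹ ∘ ξ| ≥ δ`, on which the kernel is not singular. -/
def farPairs (n : ℕ) (δ : ℝ) : Set (Heis n × Heis n) :=
  {z | δ ≤ stdNorm (mul (inv z.2) z.1)}

theorem measurableSet_farPairs (n : ℕ) (δ : ℝ) : MeasurableSet (farPairs n δ) :=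
  (isClosed_le continuous_const
    (isHomogeneousNorm_stdNorm.continuous.comp continuous_inv_mul)).measurableSet

theorem swap_mem_farPairs {z : Heis n × Heis n} : z.swap ∈ farPairs n δ ↔ z ∈ farPairs n δ := by
  simp only [farPairs, Set.mem_ofPred_eq, Prod.fst_swap, Prod.snd_swap, stdNorm_inv_mul_comm z.1]

theorem integrableOn_farPairs_fst (hs : 0 < s) (hp : 0 < p) (hδ : 0 < δ) {F : Heis n → ℝ}
    (hF : Integrable F) :
    IntegrableOn (fun z => F z.1) (farPairs n δ) (kernelMeasure stdNorm s p) := by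
  have hfar : MeasurableSet {ζ : Heis n | δ ≤ stdNorm ζ} :=
    (isClosed_le continuous_const isHomogeneousNorm_stdNorm.continuous).measurableSet
  have hkernel := (integrable_indicator_iff hfar).2
    (integrableOn_stdNorm_rpow (homDim_lt_add_mul (n := n) hs hp) hδ)
  have hprod := measurePreserving_prodMk_inv_mul.integrable_comp_of_integrable
    (hF.mul_prod hkernel)
  rw [isHomogeneousNorm_stdNorm.integrableOn_kernelMeasure_iff,
    ← integrable_indicator_iff (measurableSet_farPairs n δ)]
  refine hprod.congr (.of_forall fun z => ?_)
  by_cases hz : z ∈ farPairs n δ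
  · rw [Function.comp_apply, Set.indicator_of_mem (s := {ζ | δ ≤ stdNorm ζ}) hz,
      Set.indicator_of_mem hz, kernel]
  · rw [Function.comp_apply, Set.indicator_of_notMem (s := {ζ | δ ≤ stdNorm ζ}) hz,
      Set.indicator_of_notMem hz, mul_zero]

theorem integrableOn_farPairs_snd (hs : 0 < s) (hp : 0 < p) (hδ : 0 < δ) {F : Heis n → ℝ}
    (hF : Integrable F) :
    IntegrableOn (fun z => F z.2) (farPairs n δ) (kernelMeasure stdNorm s p) := by
  have hfst := integrableOn_farPairs_fst hs hp hδ hF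
  rw [isHomogeneousNorm_stdNorm.integrableOn_kernelMeasure_iff,
    ← integrable_indicator_iff (measurableSet_farPairs n δ)] at hfst ⊢
  refine hfst.swap.congr (.of_forall fun z => ?_)
  by_cases hz : z ∈ farPairs n δ
  · rw [Function.comp_apply, Set.indicator_of_mem (swap_mem_farPairs.2 hz),
      Set.indicator_of_mem hz, Prod.fst_swap, kernel_stdNorm_swap]
  · rw [Function.comp_apply, Set.indicator_of_notMem (mt swap_mem_farPairs.1 hz),
      Set.indicator_of_notMem hz]

theorem memLp_incr_farPairs (hs : 0 < s) (hp : 0 < p) (hδ : 0 < δ)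
    (hu : MemLp u (ENNReal.ofReal p)) :
    MemLp (incr u) (ENNReal.ofReal p) ((kernelMeasure stdNorm s p).restrict (farPairs n δ)) := by
  have hac : (kernelMeasure stdNorm s p).restrict (farPairs n δ) ≪
      (volume : Measure (Heis n)).prod volume :=
    Measure.absolutelyContinuous_restrict.trans (kernelMeasure_absolutelyContinuous _ s p)
  have hup := integrable_abs_rpow hp hu
  exact ((memLp_ofReal_iff hp (hu.1.comp_fst.mono_ac hac)).2
      (integrableOn_farPairs_fst hs hp hδ hup)).sub
    ((memLp_ofReal_iff hp (hu.1.comp_snd.mono_ac hac)).2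
      (integrableOn_farPairs_snd hs hp hδ hup))

theorem incr_eq_zero_of_notMem_farPairs (hsep : ∀ ξ ∈ Ω, ∀ η ∉ Ω', δ ≤ stdNorm (mul (inv η) ξ))
    (hsub : Ω ⊆ Ω') {z : Heis n × Heis n} (hfst : z.1 ∉ Ω → u z.1 = 0) (hsnd : z.2 ∉ Ω → u z.2 = 0)
    (hz : z ∉ Ω' ×ˢ Ω') (hfar : z ∉ farPairs n δ) : incr u z = 0 := by
  have hz1 : z.1 ∉ Ω := fun h1 => hfar (hsep _ h1 _ fun h2 => hz ⟨hsub h1, h2⟩)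
  have hz2 : z.2 ∉ Ω := fun h2 => hfar <| swap_mem_farPairs.1 <|
    hsep _ h2 _ fun h1 => hz ⟨h1, hsub h2⟩
  rw [incr_apply, hfst hz1, hsnd hz2, sub_zero]

theorem MemWsp.hasFiniteEnergy_of_ae_eq_zero (hs : 0 < s) (hp : 0 < p) (hΩ : MeasurableSet Ω)
    (hΩb : Bornology.IsBounded Ω) (hΩ' : IsOpen Ω') (hsub : closure Ω ⊆ Ω')
    (hu : MemWsp s p Ω' u) (hu0 : ∀ᵐ ξ ∂volume.restrict Ωᶜ, u ξ = 0) :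
    HasFiniteEnergy volume (kernelMeasure stdNorm s p) p u := by
  obtain ⟨δ, hδ, hsep⟩ := exists_le_stdNorm_of_notMem hΩb hΩ' hsub
  have hΩΩ' : Ω ⊆ Ω' := subset_closure.trans hsub
  have hE := (memWsp_iff_hasFiniteEnergy hp).1 hu
  have huLp : MemLp u (ENNReal.ofReal p) :=
    memLp_of_memLp_restrict hΩ (hE.memLp.mono_measure (Measure.restrict_mono_set _ hΩΩ'))
      (MemLp.zero.ae_eq (EventuallyEq.symm hu0))
  refine ⟨huLp, memLp_of_memLp_restrict (hΩ'.measurableSet.prod hΩ'.measurableSet)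
    hE.memLp_incr ?_⟩
  have hfar := (memLp_indicator_iff_restrict (measurableSet_farPairs n δ)).2
    (memLp_incr_farPairs hs hp hδ huLp)
  refine (hfar.restrict (Ω' ×ˢ Ω')ᶜ).ae_eq ?_
  have hu0' : ∀ᵐ ξ : Heis n, ξ ∉ Ω → u ξ = 0 := (ae_restrict_iff' hΩ.compl).1 hu0
  have hac := kernelMeasure_absolutelyContinuous (stdNorm (n := n)) s p
  filter_upwards [ae_restrict_mem (hΩ'.measurableSet.prod hΩ'.measurableSet).compl,
    ae_restrict_of_ae (hac.ae_le (Measure.quasiMeasurePreserving_fst.ae hu0')),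
    ae_restrict_of_ae (hac.ae_le (Measure.quasiMeasurePreserving_snd.ae hu0'))] with z hz hfst hsnd
  exact Set.indicator_apply_eq_self.2
    (incr_eq_zero_of_notMem_farPairs hsep hΩΩ' hfst hsnd hz)

end Sobolev

/-! ### The obstacle problem -/

section ObstacleProblem

variable {n : ℕ} {s p : ℝ} {d u v g : Heis n → ℝ} {h : Heis n → EReal}
  {Ω Ω' : Set (Heis n)}

theorem mem_obstacleClass_iff (hs : 0 < s) (hp : 0 < p) (hd : IsHomogeneousNorm d)
    (hΩ : MeasurableSet Ω) (hΩb : Bornology.IsBounded Ω) (hΩ' : IsOpen Ω')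
    (hsub : closure Ω ⊆ Ω') (hg : MemWsp s p Set.univ g) :
    u ∈ obstacleClass s p g h Ω Ω' ↔ HasFiniteEnergy volume (kernelMeasure d s p) p u ∧
      (∀ᵐ ξ ∂volume.restrict Ω, h ξ ≤ (u ξ : EReal)) ∧
      ∀ᵐ ξ ∂volume.restrict Ωᶜ, u ξ = g ξ := by
  rw [hasFiniteEnergy_kernelMeasure_iff hd isHomogeneousNorm_stdNorm (homDim_add_mul_pos hs hp)]
  rw [memWsp_univ_iff hp] at hg
  have hg' : HasFiniteEnergy (volume.restrict Ω')
      ((kernelMeasure stdNorm s p).restrict (Ω' ×ˢ Ω')) p g :=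
    hg.mono_measure Measure.restrict_le_self Measure.restrict_le_self
  refine and_congr_left fun hu => ⟨fun hW => ?_, fun hE => (memWsp_iff_hasFiniteEnergy hp).2
    (hE.mono_measure Measure.restrict_le_self Measure.restrict_le_self)⟩
  have hsubW : MemWsp s p Ω' (u - g) := (memWsp_iff_hasFiniteEnergy hp).2
    (((memWsp_iff_hasFiniteEnergy hp).1 hW).sub hg')
  have hsub0 : ∀ᵐ ξ ∂volume.restrict Ωᶜ, (u - g) ξ = 0 := hu.2.mono fun ξ hξ => sub_eq_zero.2 hξ
  simpa only [sub_add_cancel] using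
    (hsubW.hasFiniteEnergy_of_ae_eq_zero hs hp hΩ hΩb hΩ' hsub hsub0).add hg

theorem exists_ball_disjoint (hΩb : Bornology.IsBounded Ω) : ∃ c, Disjoint Ω (Metric.ball c 1) := by
  obtain ⟨R, hR⟩ := hΩb.subset_closedBall 0
  obtain ⟨c, hc⟩ := NormedSpace.exists_lt_norm ℝ (Heis n) (R + 1)
  exact ⟨c, (Metric.closedBall_disjoint_ball (by simpa using hc.le)).mono_left hR⟩

theorem exists_integral_abs_rpow_le_gagliardo (hs : 0 < s) (hp : 0 < p) (hd : IsHomogeneousNorm d)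
    (hΩ : MeasurableSet Ω) (hΩb : Bornology.IsBounded Ω) :
    ∃ C : ℝ, 0 ≤ C ∧ ∀ w, HasFiniteEnergy volume (kernelMeasure d s p) p w →
      (∀ᵐ ξ ∂volume.restrict Ωᶜ, w ξ = 0) →
      ∫ ξ, |w ξ| ^ p ≤ C * gagliardo (kernelMeasure d s p) p w := by
  obtain ⟨c, hc⟩ := exists_ball_disjoint hΩb
  obtain ⟨C, hC⟩ := exists_prod_restrict_le_smul_kernelMeasure hd (homDim_add_mul_pos hs hp).le hΩ
    Metric.isOpen_ball.measurableSet hΩb Metric.isBounded_ball hc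
  have hball : 0 < volume.real (Metric.ball c 1) :=
    ENNReal.toReal_pos (Metric.measure_ball_pos volume c one_pos).ne' measure_ball_lt_top.ne
  refine ⟨(volume.real (Metric.ball c 1))⁻¹ * C, by positivity, fun w hw hw0 => ?_⟩
  rw [_root_.mul_assoc, le_inv_mul_iff₀ hball]
  exact measureReal_mul_integral_abs_rpow_le_gagliardo hp hw hc hΩ hw0 hC

theorem isAdmissibleClass_obstacleClass (hs : 0 < s) (hp : 0 < p) (hd : IsHomogeneousNorm d)
    (hΩ : MeasurableSet Ω) (hΩb : Bornology.IsBounded Ω) (hΩ' : IsOpen Ω')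
    (hsub : closure Ω ⊆ Ω') (hg : MemWsp s p Set.univ g) (h : Heis n → EReal) :
    IsAdmissibleClass volume (kernelMeasure d s p) p (obstacleClass s p g h Ω Ω') := by
  have hmem : ∀ {u}, u ∈ obstacleClass s p g h Ω Ω' ↔ _ :=
    mem_obstacleClass_iff hs hp hd hΩ hΩb hΩ' hsub hg
  refine ⟨fun u hu => (hmem.1 hu).1, ?_, ?_, ?_⟩
  · intro u hu v hv a b ha hb hab
    obtain ⟨huE, huh, hug⟩ := hmem.1 hu
    obtain ⟨hvE, hvh, hvg⟩ := hmem.1 hv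
    refine hmem.2 ⟨(huE.const_smul a).add (hvE.const_smul b), ?_, ?_⟩
    · filter_upwards [huh, hvh] with ξ hξu hξv
      exact (Set.ordConnected_Ici.preimage_mono EReal.coe_strictMono.monotone).convex hξu hξv
        ha hb hab
    · filter_upwards [hug, hvg] with ξ hξu hξv
      exact convex_singleton (g ξ) hξu hξv ha hb hab
  · intro w u hw huE hlim
    refine hmem.2 ⟨huE, ?_, ?_⟩
    · filter_upwards [ae_all_iff.2 fun k => (hmem.1 (hw k)).2.1, ae_restrict_of_ae hlim]
        with ξ hξ hξlim
      exact ge_of_tendsto' ((continuous_coe_real_ereal.tendsto _).comp hξlim) hξ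
    · filter_upwards [ae_all_iff.2 fun k => (hmem.1 (hw k)).2.2, ae_restrict_of_ae hlim]
        with ξ hξ hξlim
      exact tendsto_nhds_unique hξlim (tendsto_const_nhds.congr fun k => (hξ k).symm)
  · obtain ⟨C, hC0, hC⟩ := exists_integral_abs_rpow_le_gagliardo hs hp hd hΩ hΩb
    refine ⟨C, hC0, fun u hu v hv => ?_⟩
    obtain ⟨huE, -, hug⟩ := hmem.1 hu
    obtain ⟨hvE, -, hvg⟩ := hmem.1 hv
    refine hC _ (huE.sub hvE) ?_
    filter_upwards [hug, hvg] with ξ hξu hξv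
    rw [Pi.sub_apply, hξu, hξv, sub_self]

theorem formIntegrand_eq (d : Heis n → ℝ) (s p : ℝ) (u v : Heis n → ℝ) :
    formIntegrand d s p u v = fun z => flux p (incr u z) * incr v z * kernel d s p z := by
  ext z
  rw [formIntegrand, div_eq_mul_inv]
  rfl

theorem IsHomogeneousNorm.integrable_formIntegrand (hd : IsHomogeneousNorm d) (hp : 1 < p)
    (hu : HasFiniteEnergy volume (kernelMeasure d s p) p u)
    (hv : HasFiniteEnergy volume (kernelMeasure d s p) p v) :
    Integrable (formIntegrand d s p u v) := by
  rw [formIntegrand_eq]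
  exact hd.integrable_kernelMeasure_iff.1 (integrable_flux_mul hp hu.memLp_incr hv.memLp_incr)

theorem IsHomogeneousNorm.pairing_eq_weakForm (hd : IsHomogeneousNorm d) {f φ : Heis n → ℝ → ℝ}
    (hφ : φ =ᵐ[volume.restrict Ω] f) (u v : Heis n → ℝ) :
    pairing d s p f Ω u v = weakForm (kernelMeasure d s p) (volume.restrict Ω) p φ u v := by
  rw [pairing, weakForm, formIntegrand_eq, hd.integral_kernelMeasure]
  congr 1
  refine integral_congr_ae ?_
  filter_upwards [hφ] with ξ hξ
  rw [hξ]

end ObstacleProblem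

end Heis

end

open Heis NonlocalObstacle in
theorem theorem1_general {n : ℕ} {s p : ℝ} (hs : 0 < s) (hp : 1 < p) {d : Heis n → ℝ}
    (hd : IsHomogeneousNorm d) {Ω Ω' : Set (Heis n)} (hΩ : MeasurableSet Ω)
    (hΩb : Bornology.IsBounded Ω) (hΩ' : IsOpen Ω') (hsub : closure Ω ⊆ Ω')
    {f : Heis n → ℝ → ℝ} (hf_meas : ∀ x, AEMeasurable (fun ξ => f ξ x) (volume.restrict Ω))
    (hf_cont : ∀ᵐ ξ ∂volume.restrict Ω, Continuous (f ξ))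
    (hf_bdd : ∃ M : ℝ, ∀ x, ∀ᵐ ξ ∂volume.restrict Ω, |f ξ x| ≤ M)
    (hf_mono : ∀ x₁ x₂, ∀ᵐ ξ ∂volume.restrict Ω, (f ξ x₁ - f ξ x₂) * (x₁ - x₂) ≤ 0)
    {g : Heis n → ℝ} (hg : MemWsp s p Set.univ g) {h : Heis n → EReal}
    (hne : (obstacleClass s p g h Ω Ω').Nonempty) :
    (∀ u ∈ obstacleClass s p g h Ω Ω', ∀ v ∈ obstacleClass s p g h Ω Ω',
      Integrable (formIntegrand d s p u (v - u)) ∧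
      IntegrableOn (fun ξ => f ξ (u ξ) * (v - u) ξ) Ω) ∧
    ∃ u, IsObstacleSolution d s p f g h Ω Ω' u ∧
      ∀ w, IsObstacleSolution d s p f g h Ω Ω' w → w =ᵐ[volume] u := by
  have : IsFiniteMeasure (volume.restrict Ω) := isFiniteMeasure_restrict.2 hΩb.measure_lt_top.ne
  obtain ⟨M, hM⟩ := hf_bdd
  obtain ⟨φ, hφ, hφf⟩ := exists_isBoundedForcing hf_meas hf_cont hM hf_mono
  have hK := isAdmissibleClass_obstacleClass hs (zero_lt_one.trans hp) hd hΩ hΩb hΩ' hsub hg h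
  refine ⟨fun u hu v hv => ?_, ?_⟩
  · have huE := hK.hasFiniteEnergy u hu
    have hvuE := (hK.hasFiniteEnergy v hv).sub huE
    refine ⟨hd.integrable_formIntegrand hp huE hvuE, (hφ.integrable_mul huE.memLp.1.restrict
      (integrable_of_memLp_of_le hp.le Measure.restrict_le_self hvuE.memLp)).congr ?_⟩
    filter_upwards [hφf] with ξ hξ
    rw [hξ]
  · obtain ⟨u, hu, hsol, huniq⟩ := hK.exists_weakForm_nonneg_and_ae_eq (ρ := volume.restrict Ω) hp
      (kernelMeasure_absolutelyContinuous d s p) Measure.restrict_le_self hφ hne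
    simp only [IsObstacleSolution, hd.pairing_eq_weakForm hφf]
    exact ⟨u, ⟨hu, hsol⟩, fun w hw => huniq w hw.1 hw.2⟩

theorem theorem1 {n : ℕ} {s p : ℝ} (hs : s ∈ Set.Ioo (0 : ℝ) 1) (hp : 1 < p)
    {d : Heis n → ℝ} (hd : Heis.IsHomogeneousNorm d)
    {Ω Ω' : Set (Heis n)} (hΩ : IsOpen Ω) (hΩ' : IsOpen Ω')
    (hΩ'b : Bornology.IsBounded Ω') (hsub : closure Ω ⊆ Ω')
    {f : Heis n → ℝ → ℝ} (hf_car : Heis.IsCaratheodory f)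
    (hf_bdd : Heis.IsLocBoundedUnif f Ω) (hf_mono : Heis.IsNonincreasing f)
    {g : Heis n → ℝ} (hg : Heis.MemWsp s p Set.univ g)
    {h : Heis n → EReal} (hh : ∀ ξ, h ξ < ⊤)
    (hne : (Heis.obstacleClass s p g h Ω Ω').Nonempty) :
    -- the integrals in `⟨A(u), v - u⟩` converge absolutely for all admissible `u`, `v`
    (∀ u ∈ Heis.obstacleClass s p g h Ω Ω', ∀ v ∈ Heis.obstacleClass s p g h Ω Ω',
      MeasureTheory.Integrable (Heis.formIntegrand d s p u (v - u)) ∧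
      MeasureTheory.IntegrableOn (fun ξ => f ξ (u ξ) * (v - u) ξ) Ω) ∧
    -- there is a solution, and it is unique up to equality almost everywhere
    ∃ u, Heis.IsObstacleSolution d s p f g h Ω Ω' u ∧
      ∀ w, Heis.IsObstacleSolution d s p f g h Ω Ω' w → w =ᵐ[MeasureTheory.volume] u :=
  theorem1_general hs.1 hp hd hΩ.measurableSet (hΩ'b.subset (subset_closure.trans hsub)) hΩ' hsub
    (fun x => (hf_car.1 x).restrict) (ae_restrict_of_ae hf_car.2) hf_bdd.2
    (fun x₁ x₂ => ae_restrict_of_ae (hf_mono x₁ x₂)) hg hne
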